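/- A quantifier-free Presburger (PA) formula is a tree with inner nodes $\wedge,\vee$ whose leaves are linear inequalities $\sum_i a_ix_i+b\ge 0$ or modulo constraints $\sum_i a_ix_i\equiv r\pmod M$, $\sum_i a_ix_i\not\equiv r\pmod M$ with integer constants, $0\le r<M$, interpreted over $\mathbb Z$. Its size is the number of tree nodes plus the number of variables plus the number of bits of all constants (in binary). A Boolean formula is a tree built from variables and constants with $\neg,\wedge,\vee$; its size is the number of tree nodes plus the number of variables. A *Skolem function* for a formula $\varphi(\bar x,\bar y)$ with input variables $\bar x$ and output variables $\bar y$ is a function $f$ such that for every $\bar x$: if $\exists \bar y\,\varphi(\bar x,\bar y)$, then $\varphi(\bar x,f(\bar x))$. A *Presburger circuit* is a directed acyclic circuit over $\mathbb Z$ whose gates compute integer affine functions $b+\sum_i a_iu_i$, $\max(u,v)$, $E(u,v)$ (which is $v$ if $u=0$ and $0$ otherwise), or $\mathrm{div}_m(u)=\lfloor u/m\rfloor$ for a nonzero integer constant $m$. A *Boolean circuit* is a directed acyclic circuit with gates $\neg$, binary $\wedge$ and $\vee$, and constants. The size $|C|$ of a circuit $C$ counts input nodes, outputs, gates, wires into gates,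 and the bits of the integer constants in gates. Let $\mathsf S_{\mathsf{1PA}}(n)$ be the maximum, over all quantifier-free PA formulas $\varphi(x,y)$ of size $\le n$ with exactly one input and one output variable, of the minimum size of a Presburger circuit computing a Skolem function for $\varphi$. Let $\mathsf S_{\mathsf{bool}}(n)$ be the maximum, over all Boolean formulas $\varphi(\bar x,\bar y)$ of size $\le n$ (with any numbers of inputs and outputs), of the minimum size of a Boolean circuit computing a Skolem function for $\varphi$. **Observation.** If $\mathsf S_{\mathsf{1PA}}(n)$ is bounded by a polynomial in $n$, then so is $\mathsf S_{\mathsf{bool}}(n)$. Consequently, if $\mathsf S_{\mathsf{1PA}}(n)$ is bounded by a polynomial, then $\mathsf{NP}\subseteq\mathsf P/\mathsf{poly}$. Here $\mathsf{NP}$ is the class of languages over $\{0,1\}$ with polynomially long certificates that can be verified by a deterministic polynomial-time Turing machine, and $\mathsf P/\mathsf{poly}$ is the class of languages over $\{0,1\}$ decided by a family of Boolean circuits of polynomial size, one circuit for each input length. -/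

import Mathlib

namespace PFnS

/-! ### Circuits over a basis of gates -/

/-- A kind of gates over a value domain `A`.  `Gate W` is the type of gates whose incoming wires
start at the nodes in `W`; `eval g v` is the value of the gate `g` if node `w` carries the value
`v w`; `size g` is the contribution of `g` to the size of a circuit. -/
structure GateBasis (A : Type) where
  Gate : Type → Type
  eval : {W : Type} → Gate W → (W → A) → A
  size : {W : Type} → Gate W → ℕ

/-- A circuit (a directed acyclic graph, given in topological order) with `n` input nodes and `m`
output nodes.  The wires into the `i`-th gate start at input nodes or at earlier gates.
Gates may be used several times. -/
structure Circuit {A : Type} (B : GateBasis A) (n m : ℕ) where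
  numGates : ℕ
  gate : (i : Fin numGates) → B.Gate (Fin n ⊕ Fin i.val)
  out : Fin m → Fin n ⊕ Fin numGates

namespace Circuit

variable {A : Type} {B : GateBasis A} {n m : ℕ}

/-- The values of the first `k` gates on input `x`. -/
def gateVal (C : Circuit B n m) (x : Fin n → A) : (k : ℕ) → k ≤ C.numGates → Fin k → A
  | 0, _ => Fin.elim0
  | k + 1, h =>
      Fin.snoc (α := fun _ => A) (C.gateVal x k (Nat.le_of_succ_le h))
        (B.eval (C.gate ⟨k, h⟩) (Sum.elim x (C.gateVal x k (Nat.le_of_succ_le h))))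

/-- The function computed by a circuit. -/
def eval (C : Circuit B n m) (x : Fin n → A) (j : Fin m) : A :=
  Sum.elim x (C.gateVal x C.numGates le_rfl) (C.out j)

/-- Input nodes, output nodes, and the sizes of all gates. -/
def size (C : Circuit B n m) : ℕ :=
  n + m + ∑ i, B.size (C.gate i)

end Circuit

/-! ### Boolean circuits and Boolean formulas -/

inductive BoolGate (W : Type) : Type
  | const (b : Bool)
  | not (u : W)
  | and (u v : W)
  | or (u v : W)

def BoolGate.eval {W : Type} : BoolGate W → (W → Bool) → Bool
  | const b, _ => b
  | not u, x => !(x u)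
  | and u v, x => x u && x v
  | or u v, x => x u || x v

/-- One for the gate itself, plus the number of its incoming wires. -/
def BoolGate.size {W : Type} : BoolGate W → ℕ
  | const _ => 1
  | not _ => 2
  | and _ _ => 3
  | or _ _ => 3

def boolBasis : GateBasis Bool where
  Gate := BoolGate
  eval := BoolGate.eval
  size := BoolGate.size

/-- Boolean circuits with `n` inputs and `m` outputs. -/
abbrev BoolCircuit (n m : ℕ) := Circuit boolBasis n m

/-- Boolean formulas over the variables in `V`. -/
inductive BoolFormula (V : Type) : Type
  | const (b : Bool)
  | var (v : V)
  | not (φ : BoolFormula V)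
  | and (φ ψ : BoolFormula V)
  | or (φ ψ : BoolFormula V)

namespace BoolFormula

variable {V : Type}

def eval : BoolFormula V → (V → Bool) → Bool
  | const b, _ => b
  | var v, x => x v
  | not φ, x => !(φ.eval x)
  | and φ ψ, x => φ.eval x && ψ.eval x
  | or φ ψ, x => φ.eval x || ψ.eval x

/-- Number of nodes of the formula tree. -/
def nodes : BoolFormula V → ℕ
  | const _ => 1
  | var _ => 1
  | not φ => φ.nodes + 1
  | and φ ψ => φ.nodes + ψ.nodes + 1
  | or φ ψ => φ.nodes + ψ.nodes + 1

/-- Number of tree nodes plus number of variables. -/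
def size [Fintype V] (φ : BoolFormula V) : ℕ :=
  φ.nodes + Fintype.card V

end BoolFormula

/-- The circuit computes a Skolem function for the outputs `y` of the Boolean specification
`φ(x, y)`. -/
def BoolCircuit.IsSkolem {n m : ℕ} (C : BoolCircuit n m)
    (φ : BoolFormula (Fin n ⊕ Fin m)) : Prop :=
  ∀ x : Fin n → Bool,
    (∃ y : Fin m → Bool, φ.eval (Sum.elim x y) = true) →
      φ.eval (Sum.elim x (Circuit.eval C x)) = true

/-- Size of a minimum-size Boolean circuit computing a Skolem function for `φ`
(`⊤` if there were none). -/
noncomputable def minBoolSkolemSize {n m : ℕ} (φ : BoolFormula (Fin n ⊕ Fin m)) : ℕ∞ :=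
  ⨅ (C : BoolCircuit n m) (_ : C.IsSkolem φ), (Circuit.size C : ℕ∞)

/-- The maximal size of minimum-size Boolean Skolem circuits for Boolean formulas of
size at most `N` (with any numbers of inputs and outputs). -/
noncomputable def SBool (N : ℕ) : ℕ∞ :=
  ⨆ (n : ℕ) (m : ℕ) (φ : BoolFormula (Fin n ⊕ Fin m)) (_ : φ.size ≤ N), minBoolSkolemSize φ

/-! ### Presburger circuits and Presburger formulas -/

/-- Number of bits of the binary encoding of an integer (with a sign bit). -/
def intBits (z : ℤ) : ℕ := z.natAbs.size + 1

/-- Gates of Presburger circuits: integer linear (affine) functions `b + ∑ a · u` of any arity,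
`max`, the zero test `E`, and the floor divisions `div_m` by nonzero integer constants `m`. -/
inductive PAGate (W : Type) : Type
  | linear (b : ℤ) (terms : List (ℤ × W))
  | max (u v : W)
  | E (u v : W)
  | div (m : ℤ) (hm : m ≠ 0) (u : W)

def PAGate.eval {W : Type} : PAGate W → (W → ℤ) → ℤ
  | linear b terms, x => b + (terms.map fun t => t.1 * x t.2).sum
  | max u v, x => Max.max (x u) (x v)
  | E u v, x => if x u = 0 then x v else 0
  | div m _ u, x => (x u).fdiv m

/-- One for the gate itself, plus the number of its incoming wires, plus the number of bits of its
integer constants. -/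
def PAGate.size {W : Type} : PAGate W → ℕ
  | linear b terms => 1 + intBits b + (terms.map fun t => 1 + intBits t.1).sum
  | max _ _ => 3
  | E _ _ => 3
  | div m _ _ => 2 + intBits m

def paBasis : GateBasis ℤ where
  Gate := PAGate
  eval := PAGate.eval
  size := PAGate.size

/-- Presburger circuits with `n` inputs and `m` outputs. -/
abbrev PACircuit (n m : ℕ) := Circuit paBasis n m

/-- Quantifier-free formulas of Presburger arithmetic in negation normal form, over the variables
in `V`.  The leaves are `∑ aᵥ v + b ≥ 0`, `∑ aᵥ v ≡ r (mod M)` and `∑ aᵥ v ≢ r (mod M)` with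
`0 ≤ r < M`. -/
inductive PAFormula (V : Type) : Type
  | ge (a : V → ℤ) (b : ℤ)
  | modEq (a : V → ℤ) (M : ℕ) (r : Fin M)
  | notModEq (a : V → ℤ) (M : ℕ) (r : Fin M)
  | and (φ ψ : PAFormula V)
  | or (φ ψ : PAFormula V)

namespace PAFormula

variable {V : Type} [Fintype V]

def Holds : PAFormula V → (V → ℤ) → Prop
  | ge a b, x => 0 ≤ (∑ v, a v * x v) + b
  | modEq a M r, x => (∑ v, a v * x v) ≡ (r.val : ℤ) [ZMOD (M : ℤ)]
  | notModEq a M r, x => ¬ (∑ v, a v * x v) ≡ (r.val : ℤ) [ZMOD (M : ℤ)]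
  | and φ ψ, x => φ.Holds x ∧ ψ.Holds x
  | or φ ψ, x => φ.Holds x ∨ ψ.Holds x

/-- Number of nodes of the formula tree plus number of bits of the constants in its leaves. -/
def weight : PAFormula V → ℕ
  | ge a b => 1 + (∑ v, intBits (a v)) + intBits b
  | modEq a M r => 1 + (∑ v, intBits (a v)) + intBits (r.val : ℤ) + intBits (M : ℤ)
  | notModEq a M r => 1 + (∑ v, intBits (a v)) + intBits (r.val : ℤ) + intBits (M : ℤ)
  | and φ ψ => φ.weight + ψ.weight + 1
  | or φ ψ => φ.weight + ψ.weight + 1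

/-- Number of tree nodes, plus number of variables, plus number of bits of all constants. -/
def size (φ : PAFormula V) : ℕ :=
  φ.weight + Fintype.card V

end PAFormula

/-- The circuit computes a Skolem function for the outputs `y` of the Presburger specification
`φ(x, y)`. -/
def PACircuit.IsSkolem {n m : ℕ} (C : PACircuit n m)
    (φ : PAFormula (Fin n ⊕ Fin m)) : Prop :=
  ∀ x : Fin n → ℤ,
    (∃ y : Fin m → ℤ, φ.Holds (Sum.elim x y)) → φ.Holds (Sum.elim x (Circuit.eval C x))

/-- Size of a minimum-size Presburger circuit computing a Skolem function for `φ`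
(`⊤` if there were none). -/
noncomputable def minPASkolemSize {n m : ℕ} (φ : PAFormula (Fin n ⊕ Fin m)) : ℕ∞ :=
  ⨅ (C : PACircuit n m) (_ : C.IsSkolem φ), (Circuit.size C : ℕ∞)

/-- The maximal size of minimum-size Presburger Skolem circuits for quantifier-free Presburger
formulas of size at most `N` over one input variable and one output variable. -/
noncomputable def S1PA (N : ℕ) : ℕ∞ :=
  ⨆ (φ : PAFormula (Fin 1 ⊕ Fin 1)) (_ : φ.size ≤ N), minPASkolemSize φ

/-- A size function is bounded by a polynomial. -/
def PolyBounded (S : ℕ → ℕ∞) : Prop :=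
  ∃ p : Polynomial ℕ, ∀ N : ℕ, S N ≤ ((p.eval N : ℕ) : ℕ∞)

/-! ### The classes NP and P/poly -/

/-- A deterministic one-tape Turing machine with finitely many states and tape symbols, reading
words over `α` and accepting by halting in an accepting state. -/
structure Decider (α : Type) where
  Γ : Type
  Λ : Type
  [inhΓ : Inhabited Γ]
  [inhΛ : Inhabited Λ]
  [finΓ : Finite Γ]
  [finΛ : Finite Λ]
  machine : Turing.TM0.Machine Γ Λ
  /-- Input letters are distinct nonblank tape symbols. -/
  sym : α → Γ
  sym_injective : Function.Injective sym
  sym_ne_blank : ∀ a, sym a ≠ default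
  accept : Set Λ

attribute [instance] Decider.inhΓ Decider.inhΛ Decider.finΓ Decider.finΛ

/-- On input `w`, the machine halts after at most `t` steps, in configuration `c`. -/
def Decider.HaltsIn {α : Type} (D : Decider α) (w : List α) (t : ℕ)
    (c : Turing.TM0.Cfg D.Γ D.Λ) : Prop :=
  Nonempty (StateTransition.EvalsToInTime (Turing.TM0.step D.machine)
    (Turing.TM0.init (w.map D.sym)) (some c) t) ∧
  Turing.TM0.step D.machine c = none

/-- The language is decided by a deterministic Turing machine in polynomial time. -/
def PolyTimeDecidable {α : Type} (L : Language α) : Prop :=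
  ∃ (D : Decider α) (p : Polynomial ℕ), ∀ w : List α,
    ∃ c, D.HaltsIn w (p.eval w.length) c ∧ (w ∈ L ↔ c.q ∈ D.accept)

/-- The word `x # w`, with `#` represented by `none`. -/
def pairWord (x w : List Bool) : List (Option Bool) :=
  x.map some ++ none :: w.map some

/-- NP: languages with polynomially long certificates that are verifiable in polynomial time. -/
def NP : Set (Language Bool) :=
  {L | ∃ (V : Language (Option Bool)) (p : Polynomial ℕ), PolyTimeDecidable V ∧
    ∀ x : List Bool, x ∈ L ↔ ∃ w : List Bool, w.length ≤ p.eval x.length ∧ pairWord x w ∈ V}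

/-- P/poly: languages decided by Boolean circuits of polynomial size, one for each input length. -/
def PPoly : Set (Language Bool) :=
  {L | ∃ p : Polynomial ℕ, ∀ n : ℕ, ∃ C : BoolCircuit n 1,
    Circuit.size C ≤ p.eval n ∧
    ∀ x : Fin n → Bool, Circuit.eval C x 0 = true ↔ List.ofFn x ∈ L}

end PFnS

/-!
The first implication encodes Boolean vectors by integers: the `i`-th entry of a vector is true if
and only if the integer is divisible by the `i`-th prime.  A Boolean specification `φ(x, y)` thereby
becomes a Presburger specification over one input and one output (`BoolFormula.toPA`), of polynomial
size since the `i`-th prime is at most `2 ^ (i + 1)` by Bertrand's postulate.  By Chinese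
remaindering, a code of a vector is a linear function of its negated entries, and the entries are
recovered by divisibility tests.  So a Presburger circuit for the translated specification yields a
Skolem function for `φ` when it is run between this encoder and decoder, and Boolean gates can do
all of this: a gate of a Presburger circuit adds at most its own size to the number of bits of the
values (`PAGate.abs_eval_le`), so two's complement arithmetic of polynomial width is exact
(`PACircuit.comp_eval`).  Subtraction is a ripple-carry adder, `max` and the zero test are selections
by sign bits, and floor division is restoring division.

The second implication composes the first one with the Cook–Levin argument.  For fixed lengths of
the input and the certificate, the run of a polynomial-time verifier is simulated by a circuit of
polynomial size (`PolyTimeDecidable.exists_comp`), working with tape positions relative to the head,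
for which a step is a local operation.  The Tseitin transformation turns this circuit into a
Boolean specification whose outputs are the certificate and the values of the gates
(`Comp.exists_formula`).  Evaluating the specification on the outputs of a Skolem circuit decides
whether a certificate of the given length exists.

Circuits are built with the relation `Comp W s V`: the functions in `V` can be computed from those
in `W` by gates of total size `s`.  It composes without bookkeeping of gate indices, and
`Comp.exists_circuit` converts it into a circuit.
-/

namespace PFnS

/-! ### Values of the nodes of a circuit -/

namespace Circuit

variable {A : Type} {B : GateBasis A} {n m : ℕ}

/-- The value of the `i`-th gate of a circuit on input `x`. -/
def val (C : Circuit B n m) (x : Fin n → A) (i : Fin C.numGates) : A :=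
  C.gateVal x C.numGates le_rfl i

theorem gateVal_castLE (C : Circuit B n m) (x : Fin n → A) {k l : ℕ} (hkl : k ≤ l)
    (hl : l ≤ C.numGates) (j : Fin k) :
    C.gateVal x l hl (Fin.castLE hkl j) = C.gateVal x k (hkl.trans hl) j := by
  induction l, hkl using Nat.le_induction with
  | base => rfl
  | succ l hkl ih =>
    rw [← ih (Nat.le_of_succ_le hl)]
    exact Fin.snoc_castSucc (α := fun _ => A) _ _ (Fin.castLE hkl j)

theorem val_eq (C : Circuit B n m) (x : Fin n → A) (i : Fin C.numGates) :
    C.val x i = B.eval (C.gate i) (Sum.elim x fun j => C.val x (Fin.castLE i.2.le j)) := by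
  have h := C.gateVal_castLE x (Nat.succ_le_of_lt i.2) le_rfl (Fin.last i)
  have h2 : ∀ j : Fin i, C.val x (Fin.castLE i.2.le j) = C.gateVal x i i.2.le j :=
    fun j => C.gateVal_castLE x i.2.le le_rfl j
  simp only [h2]
  exact h.trans (Fin.snoc_last (α := fun _ => A) _ _)

end Circuit

/-! ### Functions computable by gates from given functions -/

namespace BoolGate

variable {W W' : Type}

/-- Relabel the sources of the wires into a gate. -/
def map (f : W → W') : BoolGate W → BoolGate W'
  | const b => const b
  | not u => not (f u)
  | and u v => and (f u) (f v)
  | or u v => or (f u) (f v)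

@[simp] theorem eval_map (f : W → W') (g : BoolGate W) (x : W' → Bool) :
    (g.map f).eval x = g.eval (x ∘ f) := by cases g <;> rfl

@[simp] theorem size_map (f : W → W') (g : BoolGate W) : (g.map f).size = g.size := by
  cases g <;> rfl

end BoolGate

/-- `Comp W s V` says that all functions in `V` can be computed from the functions in `W` by
Boolean gates of total size at most `s`.  Wires are identified with the functions they carry, so
that parts of circuits can be combined without any bookkeeping of gate indices. -/
inductive Comp {D : Type} (W : Set (D → Bool)) : ℕ → Set (D → Bool) → Prop
  | base : Comp W 0 W
  | weaken {s t : ℕ} {V U : Set (D → Bool)} : Comp W s V → s ≤ t → U ⊆ V → Comp W t U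
  | gate {s : ℕ} {V : Set (D → Bool)} (g : BoolGate V) : Comp W s V →
      Comp W (s + g.size) (insert (fun d => g.eval fun f => f.1 d) V)

namespace Comp

variable {D : Type} {W V U X : Set (D → Bool)} {s t : ℕ} {f g : D → Bool}

theorem of_subset (h : V ⊆ W) : Comp W s V := base.weaken (Nat.zero_le s) h

theorem mono (h : Comp W s V) (hst : s ≤ t) : Comp W t V := h.weaken hst subset_rfl

theorem trans (h : Comp W s V) (h' : Comp V t U) : Comp W (s + t) U := by
  induction h' with
  | base => exact h
  | weaken _ hst hU ih => exact ih.weaken (by omega) hU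
  | gate g _ ih => exact (ih.gate g).mono (by omega)

theorem union_right (h : Comp W s V) (X : Set (D → Bool)) : Comp (W ∪ X) s (V ∪ X) := by
  induction h with
  | base => exact base
  | weaken _ hst hU ih => exact ih.weaken hst (Set.union_subset_union_left _ hU)
  | @gate s V g _ ih =>
    rw [Set.insert_union]
    have := ih.gate (g.map (Set.inclusion (Set.subset_union_left (s := V) (t := X))))
    simp only [BoolGate.size_map, BoolGate.eval_map] at this
    exact this

theorem extend (h : Comp W s V) : Comp W s (W ∪ V) := by
  have := h.union_right W
  rwa [Set.union_self, Set.union_comm] at this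

theorem of_source (h : Comp W s V) (hW : W ⊆ X) : Comp X s V :=
  (h.union_right X).weaken le_rfl Set.subset_union_left |> fun h' => by
    rwa [Set.union_eq_self_of_subset_left hW] at h'

theorem union (h : Comp W s V) (h' : Comp W t U) : Comp W (s + t) (V ∪ U) :=
  h.extend.trans ((h'.of_source Set.subset_union_left).extend) |>.weaken le_rfl
    (Set.union_subset_union_left _ Set.subset_union_right)

/-- Computing `U` with the help of already computed functions `V`, which are dropped. -/
theorem step (h : Comp W s V) (h' : Comp (W ∪ V) t U) : Comp W (s + t) U := h.extend.trans h'

theorem finset_biUnion {ι : Type*} (I : Finset ι) {V : ι → Set (D → Bool)}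
    (h : ∀ i ∈ I, Comp W s (V i)) : Comp W (I.card * s) (⋃ i ∈ I, V i) := by
  classical
  induction I using Finset.induction_on with
  | empty => exact of_subset (by simp)
  | insert a I ha ih =>
    rw [Finset.set_biUnion_insert, Finset.card_insert_of_notMem ha]
    exact ((h a (by simp)).union (ih fun i hi => h i (by simp [hi]))).mono (by ring_nf; rfl)

theorem iUnion {ι : Type*} [Fintype ι] {V : ι → Set (D → Bool)}
    (h : ∀ i, Comp W s (V i)) : Comp W (Fintype.card ι * s) (⋃ i, V i) := by
  simpa using finset_biUnion (Finset.univ : Finset ι) (V := V) fun i _ => h i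

theorem const (b : Bool) : Comp W 1 {fun _ => b} :=
  ((base (W := W)).gate (.const b)).weaken (by simp [BoolGate.size]) (by simp [BoolGate.eval])

theorem not (hf : f ∈ W) : Comp W 2 {fun d => !f d} :=
  ((base (W := W)).gate (.not ⟨f, hf⟩)).weaken (by simp [BoolGate.size]) (by simp [BoolGate.eval])

theorem and (hf : f ∈ W) (hg : g ∈ W) : Comp W 3 {fun d => f d && g d} :=
  ((base (W := W)).gate (.and ⟨f, hf⟩ ⟨g, hg⟩)).weaken (by simp [BoolGate.size])
    (by simp [BoolGate.eval])

theorem or (hf : f ∈ W) (hg : g ∈ W) : Comp W 3 {fun d => f d || g d} :=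
  ((base (W := W)).gate (.or ⟨f, hf⟩ ⟨g, hg⟩)).weaken (by simp [BoolGate.size])
    (by simp [BoolGate.eval])

/-- Any function of one bit; likewise `apply₂` and `apply₃`, by case distinction on a bit. -/
theorem apply₁ (F : Bool → Bool) (hf : f ∈ W) : Comp W 2 {fun d => F (f d)} := by
  cases h0 : F false <;> cases h1 : F true
  · convert (const (W := W) false).mono (t := 2) (by omega) using 3 with d
    cases f d <;> assumption
  · refine of_subset ?_
    convert Set.singleton_subset_iff.2 hf using 3 with d
    cases f d <;> assumption
  · convert not hf using 3 with d
    cases f d <;> assumption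
  · convert (const (W := W) true).mono (t := 2) (by omega) using 3 with d
    cases f d <;> assumption

theorem ite (hf : f ∈ W) (hg : g ∈ W) {h : D → Bool} (hh : h ∈ W) :
    Comp W 11 {fun d => if f d then g d else h d} := by
  have h1 := (and hf hg).union ((not hf).step
    (and (f := fun d => !f d) (g := h) (by simp) (Or.inl hh)))
  have h2 := h1.step (or (f := fun d => f d && g d) (g := fun d => !f d && h d)
    (by simp) (by simp))
  convert h2 using 3 with d
  cases f d <;> simp

theorem apply₂ (F : Bool → Bool → Bool) (hf : f ∈ W) (hg : g ∈ W) :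
    Comp W 15 {fun d => F (f d) (g d)} := by
  have h := ((apply₁ (F true) hg).union (apply₁ (F false) hg)).step
    (ite (f := f) (Or.inl hf) (g := fun d => F true (g d)) (by simp)
      (h := fun d => F false (g d)) (by simp))
  convert h using 3 with d
  cases f d <;> simp

theorem apply₃ (F : Bool → Bool → Bool → Bool) (hf : f ∈ W) (hg : g ∈ W) {h : D → Bool}
    (hh : h ∈ W) : Comp W 41 {fun d => F (f d) (g d) (h d)} := by
  have h := ((apply₂ (F true) hg hh).union (apply₂ (F false) hg hh)).step
    (ite (f := f) (Or.inl hf) (g := fun d => F true (g d) (h d)) (by simp)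
      (h := fun d => F false (g d) (h d)) (by simp))
  convert h using 3 with d
  cases f d <;> simp

/-- The disjunction of a finite family. -/
theorem exists_or {ι : Type*} (I : Finset ι) {f : ι → D → Bool} (hf : ∀ i ∈ I, f i ∈ W) :
    Comp W (1 + 3 * I.card) {fun d => decide (∃ i ∈ I, f i d = true)} := by
  classical
  induction I using Finset.induction_on with
  | empty => simpa using const (W := W) false
  | insert a I ha ih =>
    have h := (ih fun i hi => hf i (by simp [hi])).step
      (or (f := f a) (g := fun d => decide (∃ i ∈ I, f i d = true))
        (Or.inl (hf a (by simp))) (by simp))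
    rw [Finset.card_insert_of_notMem ha]
    refine h.weaken (by omega) ?_
    simp [Bool.decide_or]

end Comp

/-! ### Circuits, formulas, and computable functions -/

theorem BoolFormula.comp_eval {V D : Type} (φ : BoolFormula V) {W : Set (D → Bool)}
    (z : V → D → Bool) (hz : ∀ v, z v ∈ W) :
    Comp W (3 * φ.nodes) {fun d => φ.eval fun v => z v d} := by
  induction φ with
  | const b => exact (Comp.const b).mono (by simp [nodes])
  | var v => exact Comp.of_subset (by simpa [eval] using hz v)
  | not φ ih => exact (ih.step (Comp.not (by simp))).mono (by simp [nodes]; omega)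
  | and φ ψ ih ih' =>
    refine ((ih.union ih').step (Comp.and (f := fun d => φ.eval fun v => z v d)
      (g := fun d => ψ.eval fun v => z v d) (by simp) (by simp))).mono ?_
    simp [nodes]; omega
  | or φ ψ ih ih' =>
    refine ((ih.union ih').step (Comp.or (f := fun d => φ.eval fun v => z v d)
      (g := fun d => ψ.eval fun v => z v d) (by simp) (by simp))).mono ?_
    simp [nodes]; omega

/-- The gates of a Boolean circuit. -/
def BoolCircuit.boolGate {n m : ℕ} (C : BoolCircuit n m) (i : Fin C.numGates) :
    BoolGate (Fin n ⊕ Fin i.val) := C.gate i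

theorem BoolCircuit.val_eq {n m : ℕ} (C : BoolCircuit n m) (x : Fin n → Bool)
    (i : Fin C.numGates) : Circuit.val C x i =
      (C.boolGate i).eval (Sum.elim x fun j => Circuit.val C x (Fin.castLE i.2.le j)) :=
  Circuit.val_eq C x i

theorem BoolCircuit.size_eq {n m : ℕ} (C : BoolCircuit n m) :
    Circuit.size C = n + m + ∑ i, (C.boolGate i).size := rfl

theorem BoolCircuit.comp_eval {n m : ℕ} {D : Type} (C : BoolCircuit n m) {W : Set (D → Bool)}
    (x : D → Fin n → Bool) (hx : ∀ i, (fun d => x d i) ∈ W) :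
    Comp W (Circuit.size C) (⋃ j, {fun d => Circuit.eval C (x d) j}) := by
  have key : ∀ k (hk : k ≤ C.numGates),
      Comp W (∑ i : Fin k, (C.boolGate (Fin.castLE hk i)).size)
        (W ∪ ⋃ i : Fin k, {fun d => Circuit.val C (x d) (Fin.castLE hk i)}) := by
    intro k
    induction k with
    | zero => intro hk; exact Comp.of_subset (by simp)
    | succ k ih =>
      intro hk
      have h := ih (Nat.le_of_succ_le hk)
      set V := W ∪ ⋃ i : Fin k, {fun d => Circuit.val C (x d) (Fin.castLE (Nat.le_of_succ_le hk) i)}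
      let node : Fin n ⊕ Fin k → V := Sum.elim (fun i => ⟨fun d => x d i, Or.inl (hx i)⟩)
        (fun i => ⟨fun d => Circuit.val C (x d) (Fin.castLE (Nat.le_of_succ_le hk) i),
          Or.inr (Set.mem_iUnion.2 ⟨i, rfl⟩)⟩)
      have h' := h.gate ((C.boolGate ⟨k, hk⟩).map node)
      refine h'.weaken ?_ ?_
      · rw [Fin.sum_univ_castSucc]
        rw [BoolGate.size_map]
        rfl
      · rintro f (hf | hf)
        · exact Or.inr (Or.inl hf)
        · obtain ⟨i, rfl⟩ := Set.mem_iUnion.1 hf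
          induction i using Fin.lastCases with
          | cast i => exact Or.inr (Or.inr (Set.mem_iUnion.2 ⟨i, rfl⟩))
          | last =>
            left
            funext d
            rw [BoolGate.eval_map]
            refine (C.val_eq (x d) ⟨k, hk⟩).trans ?_
            congr 1
            funext w
            cases w <;> rfl
  refine (key _ le_rfl).weaken (Nat.le_add_left _ _) ?_
  intro f hf
  obtain ⟨j, rfl⟩ := Set.mem_iUnion.1 hf
  simp only [Circuit.eval]
  rcases C.out j with i | i
  · exact Or.inl (hx i)
  · exact Or.inr (Set.mem_iUnion.2 ⟨i, rfl⟩)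

namespace BoolCircuit

variable {n : ℕ}

/-- Add a last gate to a circuit (whose outputs are dropped). -/
abbrev snoc (C : BoolCircuit n 0) (g : BoolGate (Fin n ⊕ Fin C.numGates)) : BoolCircuit n 0 where
  numGates := C.numGates + 1
  gate := Fin.snoc (α := fun i : Fin (C.numGates + 1) => BoolGate (Fin n ⊕ Fin i.val)) C.gate g
  out := Fin.elim0

theorem snoc_gate_castSucc (C : BoolCircuit n 0) (g : BoolGate (Fin n ⊕ Fin C.numGates))
    (i : Fin C.numGates) : (C.snoc g).boolGate i.castSucc = C.boolGate i :=
  Fin.snoc_castSucc (α := fun i : Fin (C.numGates + 1) => BoolGate (Fin n ⊕ Fin i.val)) _ _ _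

theorem snoc_gate_last (C : BoolCircuit n 0) (g : BoolGate (Fin n ⊕ Fin C.numGates)) :
    (C.snoc g).boolGate (Fin.last C.numGates) = g :=
  Fin.snoc_last (α := fun i : Fin (C.numGates + 1) => BoolGate (Fin n ⊕ Fin i.val)) _ _

theorem snoc_val_castSucc (C : BoolCircuit n 0) (g : BoolGate (Fin n ⊕ Fin C.numGates))
    (x : Fin n → Bool) (i : Fin C.numGates) :
    Circuit.val (C.snoc g) x i.castSucc = Circuit.val C x i := by
  obtain ⟨i, hi⟩ := i
  induction i using Nat.strong_induction_on with
  | _ i ih =>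
    rw [val_eq, val_eq, snoc_gate_castSucc]
    congr 2
    funext j
    exact ih j j.2 (j.2.trans hi)

theorem snoc_val_last (C : BoolCircuit n 0) (g : BoolGate (Fin n ⊕ Fin C.numGates))
    (x : Fin n → Bool) :
    Circuit.val (C.snoc g) x (Fin.last C.numGates) = g.eval (Sum.elim x (Circuit.val C x)) := by
  rw [val_eq, snoc_gate_last]
  congr 2
  funext j
  exact snoc_val_castSucc C g x j

theorem size_snoc (C : BoolCircuit n 0) (g : BoolGate (Fin n ⊕ Fin C.numGates)) :
    Circuit.size (C.snoc g) = Circuit.size C + g.size := by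
  rw [size_eq, size_eq, Fin.sum_univ_castSucc, snoc_gate_last]
  simp only [snoc_gate_castSucc]
  exact (Nat.add_assoc _ _ _).symm

end BoolCircuit

/-- The functions carried by the input nodes. -/
def inputs (I : Type) : Set ((I → Bool) → Bool) := Set.range fun i x => x i

theorem Comp.exists_nodes {n s : ℕ} {V : Set ((Fin n → Bool) → Bool)}
    (h : Comp (inputs (Fin n)) s V) :
    ∃ C : BoolCircuit n 0, Circuit.size C ≤ n + s ∧
      ∀ f ∈ V, ∃ w, ∀ x, f x = Sum.elim x (Circuit.val C x) w := by
  induction h with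
  | base =>
    refine ⟨⟨0, fun i => i.elim0, Fin.elim0⟩, by simp [Circuit.size], ?_⟩
    rintro _ ⟨i, rfl⟩
    exact ⟨Sum.inl i, fun x => rfl⟩
  | weaken _ hst hU ih =>
    obtain ⟨C, hC, hV⟩ := ih
    exact ⟨C, hC.trans (by omega), fun f hf => hV f (hU hf)⟩
  | @gate s V g _ ih =>
    obtain ⟨C, hC, hV⟩ := ih
    choose w hw using hV
    refine ⟨C.snoc (g.map fun f => w f.1 f.2), ?_, ?_⟩
    · rw [BoolCircuit.size_snoc, BoolGate.size_map]; omega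
    · rintro f (rfl | hf)
      · refine ⟨Sum.inr (Fin.last C.numGates), fun x => ?_⟩
        refine Eq.trans ?_ (BoolCircuit.snoc_val_last C _ x).symm
        rw [BoolGate.eval_map]
        exact congrArg g.eval (funext fun f => hw f.1 f.2 x)
      · refine ⟨Sum.map id Fin.castSucc (w f hf), fun x => ?_⟩
        rw [hw f hf x]
        rcases w f hf with i | i
        · rfl
        · exact (BoolCircuit.snoc_val_castSucc C _ x i).symm

theorem Comp.exists_circuit {n m s : ℕ} {F : (Fin n → Bool) → Fin m → Bool}
    (h : Comp (inputs (Fin n)) s (⋃ j, {fun x => F x j})) :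
    ∃ C : BoolCircuit n m, Circuit.size C ≤ n + m + s ∧ ∀ x, Circuit.eval C x = F x := by
  obtain ⟨C, hC, hV⟩ := h.exists_nodes
  choose w hw using fun j => hV _ (Set.mem_iUnion.2 ⟨j, rfl⟩)
  refine ⟨⟨C.numGates, C.gate, w⟩, ?_, fun x => funext fun j => ?_⟩
  · unfold Circuit.size at hC ⊢
    simp only at hC ⊢
    omega
  · rw [hw j x]
    have hv : ∀ k hk, Circuit.gateVal (⟨C.numGates, C.gate, w⟩ : BoolCircuit n m) x k hk
        = Circuit.gateVal C x k hk := by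
      intro k
      induction k with
      | zero => intro hk; rfl
      | succ k ih => intro hk; simp only [Circuit.gateVal, ih]
    show Sum.elim x (Circuit.gateVal _ x _ _) (w j) = _
    rw [hv]
    rfl

/-! ### Integer arithmetic by Boolean gates -/

section Arithmetic

variable {D : Type} {W : Set (D → Bool)} {w : ℕ} {u v t : D → ℤ}

/-- The bits of the `w`-bit two's complement representation of an integer-valued function. -/
def bits (w : ℕ) (z : D → ℤ) : Set (D → Bool) :=
  ⋃ i : Fin w, {fun d => (BitVec.ofInt w (z d)).getLsbD i}

theorem bit_mem_bits (z : D → ℤ) {i : ℕ} (hi : i < w) :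
    (fun d => (BitVec.ofInt w (z d)).getLsbD i) ∈ bits w z :=
  Set.mem_iUnion.2 ⟨⟨i, hi⟩, rfl⟩

/-- A bound for the number of gates in one operation on `w`-bit integers. -/
def opCost (w : ℕ) : ℕ := 100 * (w + 1)

/-- Subtraction is addition of the complement with an incoming carry. -/
theorem ofInt_sub_eq (x y : ℤ) : BitVec.ofInt w (x - y) =
    BitVec.ofInt w x + ~~~ BitVec.ofInt w y + BitVec.setWidth w (BitVec.ofBool true) := by
  have h : BitVec.setWidth w (BitVec.ofBool true) = 1#w := by
    ext i hi
    simp [BitVec.getElem_one]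
  rw [sub_eq_add_neg, BitVec.ofInt_add, BitVec.ofInt_neg, BitVec.neg_eq_not_add, h,
    BitVec.add_assoc]

namespace Comp

theorem intConst (c : ℤ) : Comp W (opCost w) (bits w fun _ => c) :=
  (iUnion fun _ => const _).mono (by simp [opCost]; omega)

/-- An integer that is `c` or `0`, depending on a bit. -/
theorem intOfBit {f : D → Bool} (hf : f ∈ W) (c : ℤ) :
    Comp W (opCost w) (bits w fun d => if f d then c else 0) := by
  refine (iUnion (s := 2) fun i => ?_).mono (t := opCost w) (by simp [opCost]; omega)
  convert apply₁ (fun b => (BitVec.ofInt w (if b then c else 0)).getLsbD i) hf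

/-- Subtraction by a ripple-carry adder. -/
theorem sub (hu : bits w u ⊆ W) (hv : bits w v ⊆ W) :
    Comp W (opCost w) (bits w fun d => u d - v d) := by
  let a : D → BitVec w := fun d => BitVec.ofInt w (u d)
  let b : D → BitVec w := fun d => ~~~ BitVec.ofInt w (v d)
  have key : ∀ k ≤ w, Comp W (1 + k * 82) ({fun d => BitVec.carry k (a d) (b d) true} ∪
      ⋃ i : Fin k, {fun d => (BitVec.ofInt w (u d - v d)).getLsbD i}) := by
    intro k
    induction k with
    | zero => intro _; simpa using const (W := W) true
    | succ k ih =>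
      intro hk
      have hk' : k < w := hk
      have hau : (fun d => (a d).getLsbD k) ∈ W := hu (bit_mem_bits u hk')
      have hbv : (fun d => (BitVec.ofInt w (v d)).getLsbD k) ∈ W := hv (bit_mem_bits v hk')
      have hb : ∀ d, (b d).getLsbD k = !(BitVec.ofInt w (v d)).getLsbD k := fun d => by
        simp [b, hk']
      set V := ({fun d => BitVec.carry k (a d) (b d) true} ∪
        ⋃ i : Fin k, {fun d => (BitVec.ofInt w (u d - v d)).getLsbD i} : Set (D → Bool)) with hV
      have hc : (fun d => BitVec.carry k (a d) (b d) true) ∈ W ∪ V := by simp [hV]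
      have h1 := apply₃ (fun x y z => x.atLeastTwo (!y) z) (Or.inl hau : _ ∈ W ∪ V)
        (Or.inl hbv) hc
      have h2 := apply₃ (fun x y z => x ^^ (!y ^^ z)) (Or.inl hau : _ ∈ W ∪ V)
        (Or.inl hbv) hc
      refine ((ih hk'.le).step ((h1.union h2).extend)).weaken (by omega) ?_
      rintro f (hf | hf)
      · refine Or.inr (Or.inl ?_)
        rw [Set.mem_singleton_iff] at hf ⊢
        rw [hf]
        funext d
        rw [BitVec.carry_succ, hb]
      · obtain ⟨i, rfl⟩ := Set.mem_iUnion.1 hf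
        induction i using Fin.lastCases with
        | cast i => exact Or.inl (Or.inr (Or.inr (Set.mem_iUnion.2 ⟨i, rfl⟩)))
        | last =>
          refine Or.inr (Or.inr ?_)
          rw [Set.mem_singleton_iff]
          funext d
          rw [Fin.val_last, ofInt_sub_eq, BitVec.getLsbD_add_add_bool hk']
          exact congrArg₂ _ rfl (congrArg₂ _ (hb d) rfl)
  exact (key w le_rfl).weaken (by simp [opCost]; omega) Set.subset_union_right

theorem add (hu : bits w u ⊆ W) (hv : bits w v ⊆ W) :
    Comp W (3 * opCost w) (bits w fun d => u d + v d) := by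
  have h1 := (intConst (W := W) (w := w) 0).step
    (sub (u := fun _ => 0) (v := v) Set.subset_union_right (hv.trans Set.subset_union_left))
  have h2 := h1.step (sub (u := u) (hu.trans Set.subset_union_left) Set.subset_union_right)
  convert h2.mono (t := 3 * opCost w) (by omega) using 3
  ring

theorem neg (hu : bits w u ⊆ W) : Comp W (2 * opCost w) (bits w fun d => -u d) := by
  convert ((intConst (W := W) (w := w) 0).step (sub (u := fun _ => 0) (v := u)
    Set.subset_union_right (hu.trans Set.subset_union_left))).mono (t := 2 * opCost w) (by omega)
    using 3
  exact (zero_sub _).symm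

theorem ofInt_sign {x : ℤ} (hw : 0 < w) (hx : |x| < 2 ^ (w - 1)) :
    (BitVec.ofInt w x).getLsbD (w - 1) = decide (x < 0) := by
  have := abs_lt.1 hx
  rw [← BitVec.msb_eq_getLsbD_last, BitVec.msb_eq_toInt,
    BitVec.toInt_ofInt_eq_self hw this.1.le this.2]

theorem isNonneg (hw : 0 < w) (ht : bits w t ⊆ W) (hlt : ∀ d, |t d| < 2 ^ (w - 1)) :
    Comp W 2 {fun d => decide (0 ≤ t d)} := by
  convert not (ht (bit_mem_bits t (i := w - 1) (by omega))) using 3 with d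
  rw [ofInt_sign hw (hlt d), ← decide_not]
  simp

/-- Selection by the sign bit. -/
theorem ifNonneg (hw : 0 < w) (ht : bits w t ⊆ W) (hv : bits w v ⊆ W)
    (hlt : ∀ d, |t d| < 2 ^ (w - 1)) :
    Comp W (opCost w) (bits w fun d => if 0 ≤ t d then v d else 0) := by
  refine (iUnion (s := 15) fun i => ?_).mono (t := opCost w) (by simp [opCost]; omega)
  convert apply₂ (fun x y => !x && y) (ht (bit_mem_bits t (i := w - 1) (by omega)))
    (hv (bit_mem_bits v i.2)) using 3 with d
  rw [ofInt_sign hw (hlt d)]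
  by_cases h : t d < 0
  · simp [h, not_le.2 h]
  · simp [h, not_lt.1 h]

theorem sum {ι : Type*} (I : Finset ι) {z : ι → D → ℤ} {s : ℕ}
    (h : ∀ i ∈ I, Comp W s (bits w (z i))) :
    Comp W (I.card * (s + 3 * opCost w) + opCost w) (bits w fun d => ∑ i ∈ I, z i d) := by
  classical
  induction I using Finset.induction_on with
  | empty => simpa using intConst (W := W) (w := w) 0
  | insert a I ha ih =>
    have h1 := ((h a (by simp)).union (ih fun i hi => h i (by simp [hi]))).step
      (add (Set.subset_union_left.trans Set.subset_union_right)
        (Set.subset_union_right.trans Set.subset_union_right))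
    simp only [Finset.sum_insert ha, Finset.card_insert_of_notMem ha]
    exact h1.mono (by ring_nf; omega)

/-- Multiplication by a natural constant: double and add. -/
theorem natMul (hu : bits w u ⊆ W) (k : ℕ) : ∀ a : ℕ, a < 2 ^ k →
    Comp W ((6 * k + 1) * opCost w) (bits w fun d => (a : ℤ) * u d) := by
  induction k with
  | zero =>
    intro a ha
    obtain rfl : a = 0 := by simpa using ha
    simpa using intConst (W := W) (w := w) 0
  | succ k ih =>
    intro a ha
    have h1 := (ih (a / 2) (by rw [pow_succ] at ha; omega)).step
      (add (u := fun d => ((a / 2 : ℕ) : ℤ) * u d) (v := fun d => ((a / 2 : ℕ) : ℤ) * u d)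
        Set.subset_union_right Set.subset_union_right)
    have ha2 : (a : ℤ) = ((a / 2 : ℕ) : ℤ) + ((a / 2 : ℕ) : ℤ) + ((a % 2 : ℕ) : ℤ) := by
      norm_cast; omega
    rcases Nat.mod_two_eq_zero_or_one a with h | h
    · convert h1.mono (t := (6 * (k + 1) + 1) * opCost w) (by ring_nf; omega) using 3
      rw [ha2, h]; push_cast; ring
    · have h2 := h1.step (add (v := u) Set.subset_union_right (hu.trans Set.subset_union_left))
      convert h2.mono (t := (6 * (k + 1) + 1) * opCost w) (by ring_nf; omega) using 3
      rw [ha2, h]; push_cast; ring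

theorem intMul (hu : bits w u ⊆ W) (a : ℤ) :
    Comp W (6 * intBits a * opCost w) (bits w fun d => a * u d) := by
  have h := natMul hu a.natAbs.size a.natAbs (Nat.lt_size_self _)
  rcases Int.natAbs_eq a with ha | ha
  · rw [← ha] at h
    exact h.mono (Nat.mul_le_mul_right _ (by unfold intBits; omega))
  · convert (h.step (neg Set.subset_union_right)).mono (t := 6 * intBits a * opCost w) ?_ using 3
    · conv_lhs => rw [ha]
      exact neg_mul _ _
    · simp only [intBits]; ring_nf; omega

theorem linear {Wire : Type} {z : Wire → D → ℤ} (hz : ∀ i, bits w (z i) ⊆ W) (b : ℤ)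
    (l : List (ℤ × Wire)) :
    Comp W ((1 + (l.map fun t => 1 + intBits t.1).sum) * 6 * opCost w)
      (bits w fun d => b + (l.map fun t => t.1 * z t.2 d).sum) := by
  induction l with
  | nil => simpa using (intConst (W := W) (w := w) b).mono (t := 6 * opCost w) (by omega)
  | cons t l ih =>
    have h := (ih.union (intMul (hz t.2) t.1)).step (add (u := fun d => t.1 * z t.2 d)
      (v := fun d => b + (l.map fun t => t.1 * z t.2 d).sum)
      (Set.subset_union_right.trans Set.subset_union_right)
      (Set.subset_union_left.trans Set.subset_union_right))
    simp only [List.map_cons, List.sum_cons]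
    convert h.mono (t := (1 + (1 + intBits t.1 + (l.map fun t => 1 + intBits t.1).sum)) * 6 *
      opCost w) ?_ using 3
    · ring
    · ring_nf; omega

theorem max (hw : 0 < w) (hu : bits w u ⊆ W) (hv : bits w v ⊆ W)
    (hlt : ∀ d, |u d - v d| < 2 ^ (w - 1)) :
    Comp W (5 * opCost w) (bits w fun d => Max.max (u d) (v d)) := by
  have h1 := (sub hu hv).step (ifNonneg (t := fun d => u d - v d) (v := fun d => u d - v d) hw
    Set.subset_union_right Set.subset_union_right hlt)
  have h2 := h1.step (add (v := v) Set.subset_union_right (hv.trans Set.subset_union_left))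
  convert h2.mono (t := 5 * opCost w) (by omega) using 3
  split_ifs <;> omega

/-- The zero test: `u = 0` if and only if neither `u` nor `-u` is negative. -/
theorem zeroTest (hw : 0 < w) (hu : bits w u ⊆ W) (hv : bits w v ⊆ W)
    (hlt : ∀ d, |u d| < 2 ^ (w - 1)) :
    Comp W (4 * opCost w) (bits w fun d => if u d = 0 then v d else 0) := by
  have h1 := (neg hu).union (ifNonneg hw hu hv hlt)
  have h2 := h1.step (ifNonneg (t := fun d => -u d) (v := fun d => if 0 ≤ u d then v d else 0) hw
    (Set.subset_union_left.trans Set.subset_union_right)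
    (Set.subset_union_right.trans Set.subset_union_right) (by simpa using hlt))
  convert h2.mono (t := 4 * opCost w) (by omega) using 3
  split_ifs <;> omega

/-- Restoring division of `t` by a constant `m`, for a quotient of `k` bits, which is added to
`u`. -/
theorem addDiv {m : ℕ} (hm : 0 < m) (k : ℕ) : ∀ {W : Set (D → Bool)} {t u : D → ℤ},
    bits w t ⊆ W → bits w u ⊆ W → (∀ d, 0 ≤ t d) → (∀ d, t d < m * 2 ^ k) →
    (m * 2 ^ k : ℤ) < 2 ^ (w - 1) → 0 < w →
    Comp W (11 * k * opCost w) (bits w fun d => u d + t d / m) := by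
  induction k with
  | zero =>
    intro W t u ht hu h0 hlt _ _
    refine of_subset ?_
    convert hu using 3 with d
    rw [Int.ediv_eq_zero_of_lt (h0 d) (by simpa using hlt d)]
    simp
  | succ k ih =>
    intro W t u ht hu h0 hlt hmw hw
    have hm' : (0 : ℤ) < m := by exact_mod_cast hm
    have hpos : (0 : ℤ) < m * 2 ^ k := by positivity
    have hpow : (m * 2 ^ (k + 1) : ℤ) = 2 * (m * 2 ^ k) := by ring
    rw [hpow] at hmw
    simp only [hpow] at hlt
    set c : ℤ := m * 2 ^ k with hc
    -- `t` and `u` after one step of the division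
    let t' : D → ℤ := fun d => t d - if 0 ≤ t d - c then c else 0
    let u' : D → ℤ := fun d => u d + if 0 ≤ t d - c then 2 ^ k else 0
    have hct : Comp W (2 * opCost w) (bits w (fun _ => c) ∪ bits w fun d => t d - c) := by
      have h1 := intConst (W := W) (w := w) c
      have h2 := h1.extend.trans ((sub (u := t) (v := fun _ => c)
        (ht.trans Set.subset_union_left) Set.subset_union_right).extend)
      exact h2.weaken (by omega) (Set.union_subset_union_left _ Set.subset_union_right)
    have habs : ∀ d, |t d - c| < 2 ^ (w - 1) := fun d => by
      have := h0 d
      have := hlt d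
      rw [abs_lt]; constructor <;> linarith
    have hT : Comp W (4 * opCost w) (bits w t') := by
      have h1 := hct.step (ifNonneg (t := fun d => t d - c) (v := fun _ => c) hw
        (Set.subset_union_right.trans Set.subset_union_right)
        (Set.subset_union_left.trans Set.subset_union_right) habs)
      exact (h1.step (sub (u := t) (ht.trans Set.subset_union_left)
        Set.subset_union_right)).mono (by omega)
    have hU : Comp W (7 * opCost w) (bits w u') := by
      have h1 := (hct.union (intConst (w := w) (2 ^ k))).step
        (ifNonneg (t := fun d => t d - c) (v := fun _ => 2 ^ k) hw
          ((Set.subset_union_right.trans Set.subset_union_left).trans Set.subset_union_right)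
          (Set.subset_union_right.trans Set.subset_union_right) habs)
      exact (h1.step (add (u := u) (hu.trans Set.subset_union_left)
        Set.subset_union_right)).mono (by omega)
    have hrec := ih (W := W ∪ (bits w t' ∪ bits w u')) (t := t') (u := u')
      (Set.subset_union_left.trans Set.subset_union_right)
      (Set.subset_union_right.trans Set.subset_union_right)
      (fun d => by simp only [t']; have := h0 d; split_ifs <;> omega)
      (fun d => by simp only [t']; have := hlt d; split_ifs <;> omega)
      (by linarith) hw
    convert ((hT.union hU).step hrec).mono (t := 11 * (k + 1) * opCost w) ?_ using 3 with d
    · simp only [t', u']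
      split_ifs with h
      · have h2 : t d = (t d - c) + m * 2 ^ k := by rw [hc]; ring
        conv_lhs => rw [h2, Int.add_mul_ediv_left _ _ hm'.ne']
        ring
      · simp
    · ring_nf; omega

/-- Restoring division needs a nonnegative dividend, so a multiple of `m` is added to `u` and the
quotient is corrected accordingly. -/
theorem natFloorDiv {m K : ℕ} (hm : 0 < m) (hu : bits w u ⊆ W) (hK : ∀ d, |u d| ≤ 2 ^ K)
    (hw : K + m.size + 3 ≤ w) :
    Comp W ((11 * K + 28) * opCost w) (bits w fun d => u d / m) := by
  have hm' : (0 : ℤ) < m := by exact_mod_cast hm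
  have h1 := (intConst (W := W) (w := w) (m * 2 ^ K)).step
    (add (u := u) (v := fun _ => (m * 2 ^ K : ℤ)) (hu.trans Set.subset_union_left)
      Set.subset_union_right)
  have h2 := h1.union (intConst (w := w) (-2 ^ K))
  have hmK : (2 : ℤ) ^ K ≤ m * 2 ^ K := le_mul_of_one_le_left (by positivity) (by omega)
  have hKpos : (0 : ℤ) < 2 ^ K := by positivity
  have h3 := h2.step (addDiv hm (K + 2) (t := fun d => u d + m * 2 ^ K) (u := fun _ => -2 ^ K)
    (Set.subset_union_left.trans Set.subset_union_right)
    (Set.subset_union_right.trans Set.subset_union_right)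
    (fun d => by have := abs_le.1 (hK d); linarith)
    (fun d => by
      have := abs_le.1 (hK d)
      have h : (m * 2 ^ (K + 2) : ℤ) = 4 * (m * 2 ^ K) := by ring
      rw [h]; linarith)
    (by
      calc (m * 2 ^ (K + 2) : ℤ) < 2 ^ m.size * 2 ^ (K + 2) := by
            have : (m : ℤ) < 2 ^ m.size := by exact_mod_cast Nat.lt_size_self m
            gcongr
        _ = 2 ^ (m.size + (K + 2)) := (pow_add _ _ _).symm
        _ ≤ 2 ^ (w - 1) := pow_le_pow_right₀ one_le_two (by omega))
    (by omega))
  convert h3.mono (t := (11 * K + 28) * opCost w) (by ring_nf; omega) using 3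
  rw [Int.add_mul_ediv_left _ _ hm'.ne']
  ring

theorem dvd {m K : ℕ} (hm : 0 < m) (hu : bits w u ⊆ W) (hK : ∀ d, |u d| ≤ 2 ^ K)
    (hw : K + m.size + 3 ≤ w) :
    Comp W ((11 * K + 6 * m.size + 31) * opCost w) {fun d => decide ((m : ℤ) ∣ u d)} := by
  have hm' : (0 : ℤ) < m := by exact_mod_cast hm
  have h1 := (natFloorDiv hm hu hK hw).step
    (natMul (u := fun d => u d / m) Set.subset_union_right m.size m (Nat.lt_size_self m))
  have h2 := h1.step (sub (v := u) Set.subset_union_right (hu.trans Set.subset_union_left))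
  -- `m * (u / m) - u` is the negative of the remainder
  have h3 := h2.step (isNonneg (t := fun d => m * (u d / m) - u d) (by omega)
    Set.subset_union_right fun d => by
      have h4 := Int.emod_nonneg (u d) hm'.ne'
      have h5 := Int.emod_lt_of_pos (u d) hm'
      have h6 := Int.emod_add_mul_ediv (u d) m
      have h7 : (m : ℤ) < 2 ^ (w - 1) := by
        exact_mod_cast (Nat.lt_size_self m).trans_le
          (pow_le_pow_right₀ (one_le_two : 1 ≤ 2) (by omega : m.size ≤ w - 1))
      rw [abs_lt]; constructor <;> linarith)
  convert h3.mono (t := (11 * K + 6 * m.size + 31) * opCost w) ?_ using 4 with d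
  · have h4 := Int.emod_nonneg (u d) hm'.ne'
    have h6 := Int.emod_add_mul_ediv (u d) m
    rw [Int.dvd_iff_emod_eq_zero]
    constructor <;> intro h <;> linarith
  · have : 2 ≤ opCost w := by simp [opCost]; omega
    ring_nf; omega

theorem floorDiv {m : ℤ} {K : ℕ} (hm : m ≠ 0) (hu : bits w u ⊆ W) (hK : ∀ d, |u d| ≤ 2 ^ K)
    (hw : K + intBits m + 2 ≤ w) :
    Comp W ((11 * K + 30) * opCost w) (bits w fun d => (u d).fdiv m) := by
  have hpos : 0 < m.natAbs := Int.natAbs_pos.2 hm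
  have hw' : K + m.natAbs.size + 3 ≤ w := by unfold intBits at hw; omega
  rcases Int.natAbs_eq m with h | h
  · convert (natFloorDiv hpos hu hK hw').mono (t := (11 * K + 30) * opCost w) (by gcongr; omega)
      using 3 with d
    rw [← h, Int.fdiv_eq_ediv_of_nonneg _ (by omega)]
  · have h1 := (neg hu).step (natFloorDiv (u := fun d => -u d) hpos Set.subset_union_right
      (by simpa using hK) hw')
    convert h1.mono (t := (11 * K + 30) * opCost w) (by ring_nf; omega) using 3 with d
    rw [← Int.neg_fdiv_neg, Int.fdiv_eq_ediv_of_nonneg _ (by omega)]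
    congr 1
    omega

end Comp

theorem abs_fdiv_le_abs (a b : ℤ) : |a.fdiv b| ≤ |a| := by
  rcases le_total 0 b with h | h
  · rw [Int.fdiv_eq_ediv_of_nonneg _ h]
    exact Int.abs_ediv_le_abs _ _
  · rw [← Int.neg_fdiv_neg, Int.fdiv_eq_ediv_of_nonneg _ (by omega), ← abs_neg a]
    exact Int.abs_ediv_le_abs _ _

theorem abs_lt_two_pow_intBits (a : ℤ) : |a| < 2 ^ (intBits a - 1) := by
  rw [Int.abs_eq_natAbs]
  exact_mod_cast Nat.lt_size_self a.natAbs

/-! ### Simulation of Presburger circuits -/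

theorem PAGate.abs_eval_le {Wire : Type} (g : PAGate Wire) {x : Wire → ℤ} {K : ℕ}
    (hx : ∀ i, |x i| ≤ 2 ^ K) : |g.eval x| ≤ 2 ^ (K + g.size) := by
  have hmono : (2 : ℤ) ^ K ≤ 2 ^ (K + g.size) := pow_le_pow_right₀ one_le_two (by omega)
  cases g with
  | linear b l =>
    induction l with
    | nil =>
      have := (abs_lt_two_pow_intBits b).le.trans
        (pow_le_pow_right₀ (n := K + (1 + intBits b)) one_le_two (by omega))
      simpa [eval, size] using this
    | cons t l ih =>
      have ih := ih (pow_le_pow_right₀ one_le_two (by omega))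
      simp only [eval, size, List.map_cons, List.sum_cons] at ih ⊢
      set S := (l.map fun t => 1 + intBits t.1).sum
      have h1 : |t.1 * x t.2| ≤ 2 ^ (intBits t.1 - 1) * 2 ^ K := by
        rw [abs_mul]
        exact mul_le_mul (abs_lt_two_pow_intBits _).le (hx _) (abs_nonneg _) (by positivity)
      rw [← pow_add] at h1
      have h2 := h1.trans (pow_le_pow_right₀ (n := K + (1 + intBits b + (intBits t.1 + S)))
        one_le_two (by omega))
      have h3 := ih.trans (pow_le_pow_right₀ (n := K + (1 + intBits b + (intBits t.1 + S)))
        one_le_two (by omega))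
      have h4 : K + (1 + intBits b + (1 + intBits t.1 + S)) =
        (K + (1 + intBits b + (intBits t.1 + S))) + 1 := by ring
      rw [h4, pow_succ, add_left_comm]
      exact (abs_add_le _ _).trans (by linarith)
  | max u v =>
    refine le_trans ?_ hmono
    exact abs_max_le_max_abs_abs.trans (max_le (hx u) (hx v))
  | E u v =>
    refine le_trans ?_ hmono
    simp only [eval]
    split_ifs
    · exact hx v
    · simp
  | div m hm u => exact ((abs_fdiv_le_abs _ _).trans (hx u)).trans hmono

theorem PAGate.comp_eval {Wire : Type} (g : PAGate Wire) {z : Wire → D → ℤ} {K : ℕ}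
    (hz : ∀ i, bits w (z i) ⊆ W) (hK : ∀ i d, |z i d| ≤ 2 ^ K) (hw : K + g.size + 2 ≤ w) :
    Comp W (g.size * (11 * K + 30) * opCost w) (bits w fun d => g.eval fun i => z i d) := by
  have hpow : (2 : ℤ) ^ K + 2 ^ K < 2 ^ (w - 1) := by
    calc (2 : ℤ) ^ K + 2 ^ K = 2 ^ (K + 1) := by ring
      _ < 2 ^ (w - 1) := pow_lt_pow_right₀ (by norm_num) (by cases g <;> simp [size] at hw <;> omega)
  have hpos : (0 : ℤ) < 2 ^ K := by positivity
  cases g with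
  | linear b l =>
    refine (Comp.linear hz b l).mono (Nat.mul_le_mul_right _ ?_)
    exact Nat.mul_le_mul (by simp only [size]; omega) (by omega)
  | max u v =>
    refine (Comp.max (by omega) (hz u) (hz v) fun d => ?_).mono
      (Nat.mul_le_mul_right _ (by simp only [size]; omega))
    have := abs_le.1 (hK u d)
    have := abs_le.1 (hK v d)
    rw [abs_lt]; constructor <;> linarith
  | E u v =>
    exact (Comp.zeroTest (by omega) (hz u) (hz v) fun d => (hK u d).trans_lt (by linarith)).mono
      (Nat.mul_le_mul_right _ (by simp only [size]; omega))
  | div m hm u =>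
    refine (Comp.floorDiv hm (hz u) (hK u) (by simp only [size] at hw; omega)).mono
      (Nat.mul_le_mul_right _ (Nat.le_mul_of_pos_left _ ?_))
    simp [size]

/-- The gates of a Presburger circuit. -/
def PACircuit.paGate {n m : ℕ} (C : PACircuit n m) (i : Fin C.numGates) :
    PAGate (Fin n ⊕ Fin i.val) := C.gate i

theorem PACircuit.val_eq {n m : ℕ} (C : PACircuit n m) (x : Fin n → ℤ)
    (i : Fin C.numGates) : Circuit.val C x i =
      (C.paGate i).eval (Sum.elim x fun j => Circuit.val C x (Fin.castLE i.2.le j)) :=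
  Circuit.val_eq C x i

theorem PACircuit.size_eq {n m : ℕ} (C : PACircuit n m) :
    Circuit.size C = n + m + ∑ i, (C.paGate i).size := rfl

/-- Every gate adds at most its size to the number of bits. -/
theorem PACircuit.abs_val_le {n m : ℕ} (C : PACircuit n m) {x : Fin n → ℤ} {K : ℕ}
    (hx : ∀ i, |x i| ≤ 2 ^ K) (i : Fin C.numGates) :
    |Circuit.val C x i| ≤ 2 ^ (K + ∑ j ∈ Finset.Iic i, (C.paGate j).size) := by
  induction i using WellFoundedLT.induction with
  | ind i ih =>
    rw [C.val_eq, ← Finset.Iio_insert, Finset.sum_insert (by simp), add_comm (PAGate.size _),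
      ← add_assoc]
    refine PAGate.abs_eval_le _ ?_
    rintro (j | j)
    · exact (hx j).trans (pow_le_pow_right₀ one_le_two (by omega))
    · have hj : Fin.castLE i.2.le j < i := j.2
      refine (ih _ hj).trans (pow_le_pow_right₀ one_le_two (Nat.add_le_add_left ?_ _))
      exact Finset.sum_le_sum_of_subset fun l hl =>
        Finset.mem_Iio.2 ((Finset.mem_Iic.1 hl).trans_lt hj)

theorem PACircuit.abs_val_le_size {n m : ℕ} (C : PACircuit n m) {x : Fin n → ℤ} {K : ℕ}
    (hx : ∀ i, |x i| ≤ 2 ^ K) (i : Fin C.numGates) :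
    |Circuit.val C x i| ≤ 2 ^ (K + Circuit.size C) := by
  refine (C.abs_val_le hx i).trans (pow_le_pow_right₀ one_le_two (Nat.add_le_add_left ?_ _))
  rw [C.size_eq]
  exact (Finset.sum_le_sum_of_subset (Finset.subset_univ _)).trans (Nat.le_add_left _ _)

theorem PACircuit.abs_eval_le {n m : ℕ} (C : PACircuit n m) {x : Fin n → ℤ} {K : ℕ}
    (hx : ∀ i, |x i| ≤ 2 ^ K) (j : Fin m) :
    |Circuit.eval C x j| ≤ 2 ^ (K + Circuit.size C) := by
  unfold Circuit.eval
  rcases C.out j with i | i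
  · exact (hx i).trans (pow_le_pow_right₀ one_le_two (by omega))
  · exact C.abs_val_le_size hx i

theorem PACircuit.comp_eval {n m : ℕ} (C : PACircuit n m) {x : D → Fin n → ℤ} {K : ℕ}
    (hx : ∀ i, bits w (fun d => x d i) ⊆ W) (hK : ∀ d i, |x d i| ≤ 2 ^ K)
    (hw : K + 2 * Circuit.size C + 2 ≤ w) (j : Fin m) :
    Comp W (Circuit.size C * (11 * (K + Circuit.size C) + 30) * opCost w)
      (bits w fun d => Circuit.eval C (x d) j) := by
  obtain ⟨X, hX⟩ : ∃ X, X = (11 * (K + Circuit.size C) + 30) * opCost w := ⟨_, rfl⟩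
  have key : ∀ k (hk : k ≤ C.numGates),
      Comp W ((∑ i : Fin k, (C.paGate (Fin.castLE hk i)).size) * X)
        (W ∪ ⋃ i : Fin k, bits w fun d => Circuit.val C (x d) (Fin.castLE hk i)) := by
    intro k
    induction k with
    | zero => intro hk; exact Comp.of_subset (by simp)
    | succ k ih =>
      intro hk
      have h := ih (Nat.le_of_succ_le hk)
      let z : Fin n ⊕ Fin k → D → ℤ := Sum.elim (fun i d => x d i)
        (fun i d => Circuit.val C (x d) (Fin.castLE (Nat.le_of_succ_le hk) i))
      have hg := PAGate.comp_eval (w := w) (W := W ∪ ⋃ i : Fin k, bits w fun d =>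
        Circuit.val C (x d) (Fin.castLE (Nat.le_of_succ_le hk) i)) (C.paGate ⟨k, hk⟩) (z := z)
        (K := K + Circuit.size C) ?_ ?_ ?_
      · rw [mul_assoc, ← hX] at hg
        refine (h.trans hg.extend).weaken ?_ ?_
        · rw [Fin.sum_univ_castSucc, add_mul]
          exact le_rfl
        · rintro f (hf | hf)
          · exact Or.inl (Or.inl hf)
          · obtain ⟨i, hi⟩ := Set.mem_iUnion.1 hf
            induction i using Fin.lastCases with
            | cast i => exact Or.inl (Or.inr (Set.mem_iUnion.2 ⟨i, hi⟩))
            | last =>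
              have e : (fun d => Circuit.val C (x d) (Fin.castLE hk (Fin.last k))) =
                  fun d => (C.paGate ⟨k, hk⟩).eval fun i => z i d := funext fun d =>
                (C.val_eq (x d) ⟨k, hk⟩).trans (congrArg _ (funext fun i => by cases i <;> rfl))
              rw [e] at hi
              exact Or.inr hi
      · rintro (i | i)
        · exact (hx i).trans Set.subset_union_left
        · exact (Set.subset_iUnion (fun i : Fin k => bits w fun d => Circuit.val C (x d)
            (Fin.castLE (Nat.le_of_succ_le hk) i)) i).trans Set.subset_union_right
      · rintro (i | i) d
        · exact (hK d i).trans (pow_le_pow_right₀ one_le_two (by omega))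
        · exact C.abs_val_le_size (hK d) _
      · have : (C.paGate ⟨k, hk⟩).size ≤ Circuit.size C := by
          rw [C.size_eq]
          exact (Finset.single_le_sum (f := fun i => (C.paGate i).size) (fun _ _ => Nat.zero_le _)
            (Finset.mem_univ (⟨k, hk⟩ : Fin C.numGates))).trans (Nat.le_add_left _ _)
        omega
  refine (key _ le_rfl).weaken ?_ ?_
  · rw [mul_assoc, ← hX]
    exact Nat.mul_le_mul_right _ (Nat.le_add_left _ _)
  · simp only [Circuit.eval]
    rcases C.out j with i | i
    · exact (hx i).trans Set.subset_union_left
    · exact (Set.subset_iUnion (fun i : Fin C.numGates => bits w fun d => Circuit.val C (x d)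
        (Fin.castLE le_rfl i)) i).trans Set.subset_union_right

end Arithmetic
/-! ### Chinese remaindering -/

theorem nth_prime_le_two_pow (i : ℕ) : Nat.nth Nat.Prime i ≤ 2 ^ (i + 1) := by
  induction i with
  | zero => simp [Nat.nth_prime_zero_eq_two]
  | succ i ih =>
    obtain ⟨q, hq, hlt, hle⟩ :=
      Nat.exists_prime_lt_and_le_two_mul (Nat.nth Nat.Prime i) (Nat.prime_nth_prime i).ne_zero
    have hmono := Nat.nth_strictMono Nat.infinite_setOfPred_prime
    rw [← Nat.nth_count hq] at hlt
    have h := hmono.monotone (hmono.lt_iff_lt.1 hlt)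
    rw [Nat.nth_count hq] at h
    rw [pow_succ]
    exact h.trans (by omega)

theorem nth_prime_coprime {i j : ℕ} (h : i ≠ j) :
    Nat.Coprime (Nat.nth Nat.Prime i) (Nat.nth Nat.Prime j) :=
  (Nat.coprime_primes (Nat.prime_nth_prime i) (Nat.prime_nth_prime j)).2 fun e =>
    h ((Nat.nth_strictMono Nat.infinite_setOfPred_prime).injective e)

theorem size_nth_prime_le (i : ℕ) : (Nat.nth Nat.Prime i).size ≤ i + 2 :=
  Nat.size_le.2 ((nth_prime_le_two_pow i).trans_lt (by gcongr <;> omega))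

/-- The idempotents of Chinese remaindering for the first `n` primes have polynomially many bits. -/
theorem exists_crt_idempotent {n : ℕ} (i : Fin n) : ∃ e : ℕ, e ≤ 2 ^ (n * n) ∧
    e ≡ 1 [MOD Nat.nth Nat.Prime i] ∧ ∀ j : Fin n, j ≠ i → Nat.nth Nat.Prime j ∣ e := by
  classical
  have hco : Nat.Coprime (Nat.nth Nat.Prime i)
      (∏ j ∈ Finset.univ.erase i, Nat.nth Nat.Prime (j : Fin n)) :=
    Nat.Coprime.prod_right fun j hj => nth_prime_coprime fun h =>
      (Finset.mem_erase.1 hj).1 (Fin.ext h.symm)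
  obtain ⟨e, he1, he2⟩ := Nat.chineseRemainder hco 1 0
  have hprod : Nat.nth Nat.Prime i * ∏ j ∈ Finset.univ.erase i, Nat.nth Nat.Prime (j : Fin n)
      = ∏ j : Fin n, Nat.nth Nat.Prime j :=
    Finset.mul_prod_erase _ (fun j : Fin n => Nat.nth Nat.Prime j) (Finset.mem_univ i)
  have hle : ∏ j : Fin n, Nat.nth Nat.Prime j ≤ 2 ^ (n * n) := by
    rw [pow_mul]
    refine (Finset.prod_le_pow_card Finset.univ (fun j : Fin n => Nat.nth Nat.Prime j) (2 ^ n)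
      fun j _ => (nth_prime_le_two_pow j).trans (pow_le_pow_right₀ one_le_two j.2)).trans ?_
    simp
  have hpos : 0 < ∏ j : Fin n, Nat.nth Nat.Prime j :=
    Finset.prod_pos fun j _ => (Nat.prime_nth_prime j).pos
  refine ⟨e % ∏ j : Fin n, Nat.nth Nat.Prime j, (Nat.mod_lt _ hpos).le.trans hle, ?_, ?_⟩
  · exact ((Nat.mod_modEq _ _).of_dvd (hprod ▸ dvd_mul_right _ _)).trans he1
  · intro j hj
    have h1 : Nat.nth Nat.Prime j ∣ ∏ j : Fin n, Nat.nth Nat.Prime j :=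
      Finset.dvd_prod_of_mem (fun j : Fin n => Nat.nth Nat.Prime j) (Finset.mem_univ j)
    rw [Nat.dvd_mod_iff h1]
    exact (Finset.dvd_prod_of_mem (fun j : Fin n => Nat.nth Nat.Prime j)
      (Finset.mem_erase.2 ⟨hj, Finset.mem_univ j⟩)).trans ((Nat.modEq_zero_iff_dvd).1 he2)

/-- Boolean vectors are encoded by integers: the `i`-th entry is true if and only if the integer
is divisible by the `i`-th prime.  The code is a linear function of the (negated) entries. -/
theorem exists_encoding (n : ℕ) : ∃ e : Fin n → ℤ, ∀ x : Fin n → Bool,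
    |∑ i, if x i = false then e i else 0| ≤ 2 ^ (n * n + n) ∧
    ∀ i : Fin n, (Nat.nth Nat.Prime i : ℤ) ∣ (∑ i, if x i = false then e i else 0) ↔
      x i = true := by
  choose e hle h1 h0 using fun i : Fin n => exists_crt_idempotent i
  refine ⟨fun i => e i, fun x => ⟨?_, fun i => ?_⟩⟩
  · calc |∑ i, if x i = false then (e i : ℤ) else 0|
        ≤ ∑ i, |if x i = false then (e i : ℤ) else 0| := Finset.abs_sum_le_sum_abs _ _
      _ ≤ ∑ _i : Fin n, 2 ^ (n * n) := by
        refine Finset.sum_le_sum fun i _ => ?_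
        have := hle i
        split_ifs
        · rw [Nat.abs_cast]; exact_mod_cast this
        · simp
      _ = n * 2 ^ (n * n) := by simp
      _ ≤ 2 ^ n * 2 ^ (n * n) := by
        have : (n : ℤ) ≤ 2 ^ n := by exact_mod_cast n.lt_two_pow_self.le
        gcongr
      _ = 2 ^ (n * n + n) := by rw [← pow_add, add_comm]
  · classical
    rw [← Finset.add_sum_erase _ _ (Finset.mem_univ i)]
    have hrest : (Nat.nth Nat.Prime i : ℤ) ∣
        ∑ j ∈ Finset.univ.erase i, if x j = false then (e j : ℤ) else 0 := by
      refine Finset.dvd_sum fun j hj => ?_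
      split_ifs
      · exact_mod_cast h0 j i (Finset.mem_erase.1 hj).1.symm
      · simp
    rw [dvd_add_left hrest]
    cases hx : x i
    · simp only [if_true, Bool.false_eq_true, iff_false]
      intro h
      have h2 : Nat.nth Nat.Prime i ∣ e i := by exact_mod_cast h
      have h3 := (h1 i).symm.trans ((Nat.modEq_zero_iff_dvd).2 h2)
      exact (Nat.prime_nth_prime i).one_lt.ne' (Nat.dvd_one.1 ((Nat.modEq_zero_iff_dvd).1 h3))
    · simp

/-! ### From Boolean to Presburger specifications -/

/-- The Presburger formula over one input and one output that states that `φ` has truth value `s`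
at the Boolean vectors encoded by the input and the output. -/
noncomputable def BoolFormula.toPA {n m : ℕ} :
    BoolFormula (Fin n ⊕ Fin m) → (s : Bool) → PAFormula (Fin 1 ⊕ Fin 1)
  | const b, s => .ge (fun _ => 0) (if b = s then 0 else -1)
  | var v, true => .modEq (v.elim (fun _ => Sum.elim 1 0) (fun _ => Sum.elim 0 1))
      (Nat.nth Nat.Prime (v.elim Fin.val Fin.val)) ⟨0, (Nat.prime_nth_prime _).pos⟩
  | var v, false => .notModEq (v.elim (fun _ => Sum.elim 1 0) (fun _ => Sum.elim 0 1))
      (Nat.nth Nat.Prime (v.elim Fin.val Fin.val)) ⟨0, (Nat.prime_nth_prime _).pos⟩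
  | not φ, s => φ.toPA !s
  | and φ ψ, true => .and (φ.toPA true) (ψ.toPA true)
  | and φ ψ, false => .or (φ.toPA false) (ψ.toPA false)
  | or φ ψ, true => .or (φ.toPA true) (ψ.toPA true)
  | or φ ψ, false => .and (φ.toPA false) (ψ.toPA false)

theorem BoolFormula.holds_toPA {n m : ℕ} (φ : BoolFormula (Fin n ⊕ Fin m)) (s : Bool)
    (x y : Fin 1 → ℤ) : (φ.toPA s).Holds (Sum.elim x y) ↔
      φ.eval (Sum.elim (fun i => decide ((Nat.nth Nat.Prime i : ℤ) ∣ x 0))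
        (fun j => decide ((Nat.nth Nat.Prime j : ℤ) ∣ y 0))) = s := by
  induction φ generalizing s with
  | const b => cases b <;> cases s <;> simp [toPA, eval, PAFormula.Holds]
  | var v =>
    rcases v with i | j <;> cases s <;>
      simp [toPA, eval, PAFormula.Holds, Int.modEq_zero_iff_dvd]
  | not φ ih => rw [toPA, ih, eval, Bool.not_eq_eq_eq_not]
  | and φ ψ ih ih' => 
    simp only [eval]
    cases s <;> simp only [toPA, PAFormula.Holds, ih, ih'] <;>
      cases BoolFormula.eval φ _ <;> simp
  | or φ ψ ih ih' => cases s <;> simp [toPA, eval, PAFormula.Holds, ih, ih']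

theorem BoolFormula.weight_toPA_le {n m : ℕ} (φ : BoolFormula (Fin n ⊕ Fin m)) (s : Bool) :
    (φ.toPA s).weight ≤ φ.nodes * (n + m + 9) := by
  induction φ generalizing s with
  | const b =>
    cases b <;> cases s <;> simp [toPA, nodes, PAFormula.weight, intBits]
  | var v =>
    rcases v with i | j <;> cases s <;>
      simp [toPA, nodes, PAFormula.weight, intBits]
    all_goals
      first
      | have := size_nth_prime_le i
        omega
      | have := size_nth_prime_le j
        omega
  | not φ ih => exact (ih _).trans (Nat.mul_le_mul_right _ (by simp [nodes]))
  | and φ ψ ih ih' =>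
    have h := ih s
    have h' := ih' s
    cases s <;> simp only [toPA, PAFormula.weight, nodes] <;> nlinarith
  | or φ ψ ih ih' =>
    have h := ih s
    have h' := ih' s
    cases s <;> simp only [toPA, PAFormula.weight, nodes] <;> nlinarith

/-- A bound for the size of Boolean Skolem circuits for specifications of size at most `N`,
obtained from Presburger circuits of size at most `σ`. -/
def transferBound (N σ : ℕ) : ℕ :=
  N + (5 * N + 1 + σ * (11 * (N * N + N + σ) + 30) + N * (11 * (N * N + N + σ) + 6 * N + 43)) *
    opCost (N * N + N + 2 * σ + N + 10)

/-- A Presburger Skolem circuit for the translated specification gives a Boolean one: encode the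
inputs as an integer, simulate the Presburger circuit bit by bit, and decode the output by
divisibility tests. -/
theorem BoolFormula.exists_skolem_of_toPA {n m N σ : ℕ} (φ : BoolFormula (Fin n ⊕ Fin m))
    (hN : φ.size ≤ N) (C : PACircuit 1 1) (hC : C.IsSkolem (φ.toPA true))
    (hσ : Circuit.size C ≤ σ) :
    ∃ C' : BoolCircuit n m, C'.IsSkolem φ ∧ Circuit.size C' ≤ transferBound N σ := by
  obtain ⟨e, he⟩ := exists_encoding n
  -- `e'` is only needed to turn a Boolean witness into an integer witness
  obtain ⟨e', he'⟩ := exists_encoding m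
  have hnm : n + m ≤ N := by
    simp only [size, Fintype.card_sum, Fintype.card_fin] at hN; omega
  set K := N * N + N with hK
  set w := K + 2 * σ + N + 10 with hw
  let X : (Fin n → Bool) → Fin 1 → ℤ := fun x _ => ∑ i, if x i = false then e i else 0
  let F : (Fin n → Bool) → Fin m → Bool := fun x j =>
    decide ((Nat.nth Nat.Prime j : ℤ) ∣ Circuit.eval C (X x) 0)
  have hXle : ∀ x i, |X x i| ≤ 2 ^ K := fun x _ =>
    (he x).1.trans (pow_le_pow_right₀ one_le_two (by rw [hK]; gcongr <;> omega))
  have hXdec : ∀ x, (fun i : Fin n => decide ((Nat.nth Nat.Prime i : ℤ) ∣ X x 0)) = x := by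
    intro x
    funext i
    rw [Bool.eq_iff_iff, decide_eq_true_iff]
    exact (he x).2 i
  have hF : ∀ x, (∃ y, φ.eval (Sum.elim x y) = true) → φ.eval (Sum.elim x (F x)) = true := by
    rintro x ⟨y, hy⟩
    have h := hC (X x) ⟨fun _ => ∑ i, if y i = false then e' i else 0, by
      rw [φ.holds_toPA, hXdec]
      convert hy using 3
      funext j
      rw [Bool.eq_iff_iff, decide_eq_true_iff]
      exact (he' y).2 j⟩
    rwa [φ.holds_toPA, hXdec] at h
  have h1 : Comp (inputs (Fin n)) (n * (2 + opCost w + 3 * opCost w) + opCost w)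
      (bits w fun x => X x 0) := by
    have := Comp.sum (W := inputs (Fin n)) (w := w) (Finset.univ : Finset (Fin n))
      (z := fun i x => if x i = false then e i else 0) (s := 2 + opCost w) fun i _ => by
        have h := (Comp.not (W := inputs (Fin n)) (f := fun x => x i) ⟨i, rfl⟩).step
          (Comp.intOfBit (w := w) (f := fun x => !x i) (by simp) (e i))
        convert h using 3
        simp
    simpa using this
  have h2 := h1.step (C.comp_eval (w := w) (x := X) (K := K)
    (fun i => Set.subset_union_right) hXle (by omega) 0)
  have h3 := h2.step (Comp.iUnion (V := fun j : Fin m => {fun x => F x j}) fun j => by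
    have hsz := size_nth_prime_le j
    refine (Comp.dvd (w := w) (K := K + Circuit.size C) (Nat.prime_nth_prime j).pos
      Set.subset_union_right (fun x => C.abs_eval_le (hXle x) 0) (by omega)).mono
      (t := (11 * (K + σ) + 6 * N + 43) * opCost w) (Nat.mul_le_mul_right _ (by omega)))
  obtain ⟨C', hsize, heval⟩ := h3.exists_circuit
  refine ⟨C', fun x hx => by rw [heval]; exact hF x hx, hsize.trans ?_⟩
  have hT : 2 ≤ opCost w := by simp [opCost]; omega
  have hn : n ≤ N := by omega
  have hm : m ≤ N := by omega
  rw [Fintype.card_fin]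
  unfold transferBound
  rw [← hK, ← hw]
  calc _ ≤ N + (N * (opCost w + opCost w + 3 * opCost w) + opCost w +
        σ * (11 * (K + σ) + 30) * opCost w + N * ((11 * (K + σ) + 6 * N + 43) * opCost w)) := by
        gcongr
    _ = _ := by ring

theorem exists_skolem_of_S1PA_le {N σ : ℕ} (φ : PAFormula (Fin 1 ⊕ Fin 1)) (hφ : φ.size ≤ N)
    (h : S1PA N ≤ σ) : ∃ C : PACircuit 1 1, C.IsSkolem φ ∧ Circuit.size C ≤ σ := by
  have h1 : minPASkolemSize φ < ((σ + 1 : ℕ) : ℕ∞) :=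
    ((le_iSup₂ (f := fun (φ : PAFormula (Fin 1 ⊕ Fin 1)) (_ : φ.size ≤ N) => minPASkolemSize φ)
      φ hφ).trans h).trans_lt (by exact_mod_cast Nat.lt_succ_self σ)
  obtain ⟨C, hC, hlt⟩ := by simpa only [minPASkolemSize, iInf_lt_iff] using h1
  exact ⟨C, hC, Nat.lt_succ_iff.1 (by exact_mod_cast hlt)⟩

theorem exists_skolem_of_SBool_le {n m N σ : ℕ} (φ : BoolFormula (Fin n ⊕ Fin m))
    (hφ : φ.size ≤ N) (h : SBool N ≤ σ) :
    ∃ C : BoolCircuit n m, C.IsSkolem φ ∧ Circuit.size C ≤ σ := by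
  have h0 : minBoolSkolemSize φ ≤ SBool N :=
    le_trans (le_iSup₂ (f := fun (φ : BoolFormula (Fin n ⊕ Fin m)) (_ : φ.size ≤ N) =>
      minBoolSkolemSize φ) φ hφ) (le_iSup₂ (f := fun n m =>
        ⨆ (φ : BoolFormula (Fin n ⊕ Fin m)) (_ : φ.size ≤ N), minBoolSkolemSize φ) n m)
  have h1 : minBoolSkolemSize φ < ((σ + 1 : ℕ) : ℕ∞) :=
    (h0.trans h).trans_lt (by exact_mod_cast Nat.lt_succ_self σ)
  obtain ⟨C, hC, hlt⟩ := by simpa only [minBoolSkolemSize, iInf_lt_iff] using h1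
  exact ⟨C, hC, Nat.lt_succ_iff.1 (by exact_mod_cast hlt)⟩

theorem polyBounded_SBool (h : PolyBounded S1PA) : PolyBounded SBool := by
  obtain ⟨P, hP⟩ := h
  have key : ∀ N, SBool N ≤ (transferBound N (P.eval (N * (N + 9) + 2)) : ℕ) := by
    intro N
    refine iSup₂_le fun n m => iSup₂_le fun φ hφ => ?_
    have hsize : (φ.toPA true).size ≤ N * (N + 9) + 2 := by
      have h1 := φ.weight_toPA_le true
      have h2 : φ.nodes + (n + m) ≤ N := by
        simpa only [BoolFormula.size, Fintype.card_sum, Fintype.card_fin] using hφ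
      have h3 : φ.nodes * (n + m + 9) ≤ N * (N + 9) := Nat.mul_le_mul (by omega) (by omega)
      simp only [PAFormula.size, Fintype.card_sum, Fintype.card_fin]
      omega
    obtain ⟨C, hC, hCs⟩ := exists_skolem_of_S1PA_le _ hsize (hP _)
    obtain ⟨C', hC', hs⟩ := φ.exists_skolem_of_toPA hφ C hC hCs
    exact (iInf₂_le C' hC').trans (by exact_mod_cast hs)
  open Polynomial in
  let σ : Polynomial ℕ := P.comp (X * (X + 9) + 2)
  open Polynomial in
  refine ⟨X + (5 * X + 1 + σ * (11 * (X * X + X + σ) + 30) +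
    X * (11 * (X * X + X + σ) + 6 * X + 43)) * (100 * ((X * X + X + 2 * σ + X + 10) + 1)),
    fun N => (key N).trans (le_of_eq ?_)⟩
  simp [σ, transferBound, opCost, Polynomial.eval_comp]

/-! ### Circuits as existential formulas -/

namespace BoolFormula

variable {V V' : Type}

/-- Rename the variables of a formula. -/
def map (f : V → V') : BoolFormula V → BoolFormula V'
  | const b => const b
  | var v => var (f v)
  | not φ => not (φ.map f)
  | and φ ψ => and (φ.map f) (ψ.map f)
  | or φ ψ => or (φ.map f) (ψ.map f)

theorem eval_map (f : V → V') (φ : BoolFormula V) (x : V' → Bool) :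
    (φ.map f).eval x = φ.eval (x ∘ f) := by
  induction φ <;> simp_all [map, eval]

theorem nodes_map (f : V → V') (φ : BoolFormula V) : (φ.map f).nodes = φ.nodes := by
  induction φ <;> simp_all [map, nodes]

/-- The biconditional. -/
def iff (φ ψ : BoolFormula V) : BoolFormula V := or (and φ ψ) (and (not φ) (not ψ))

theorem eval_iff (φ ψ : BoolFormula V) (x : V → Bool) :
    (φ.iff ψ).eval x = true ↔ φ.eval x = ψ.eval x := by
  simp only [iff, eval]
  cases φ.eval x <;> cases ψ.eval x <;> decide

end BoolFormula

/-- A gate as a formula over the sources of its wires. -/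
def BoolGate.toFormula {V : Type} : BoolGate V → BoolFormula V
  | const b => .const b
  | not u => .not (.var u)
  | and u v => .and (.var u) (.var v)
  | or u v => .or (.var u) (.var v)

theorem BoolGate.eval_toFormula {V : Type} (g : BoolGate V) (x : V → Bool) :
    g.toFormula.eval x = g.eval x := by cases g <;> rfl

/-- The Tseitin transformation: a formula with one additional variable per gate expresses that
the additional variables carry the values of the gates. -/
theorem Comp.exists_tseitin {I : Type} {s : ℕ} {V : Set ((I → Bool) → Bool)}
    (h : Comp (inputs I) s V) : ∃ (k : ℕ) (θ : BoolFormula (I ⊕ Fin k)), k ≤ s ∧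
      θ.nodes ≤ 14 * s + 1 ∧ (∀ x, ∃ z, θ.eval (Sum.elim x z) = true) ∧
      ∀ f ∈ V, ∃ v, ∀ x z, θ.eval (Sum.elim x z) = true → f x = Sum.elim x z v := by
  induction h with
  | base =>
    refine ⟨0, .const true, le_rfl, le_rfl, fun _ => ⟨Fin.elim0, rfl⟩, ?_⟩
    rintro _ ⟨i, rfl⟩
    exact ⟨Sum.inl i, fun _ _ _ => rfl⟩
  | weaken _ hst hU ih =>
    obtain ⟨k, θ, hk, hθ, hsat, hV⟩ := ih
    exact ⟨k, θ, by omega, by omega, hsat, fun f hf => hV f (hU hf)⟩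
  | @gate s V g _ ih =>
    obtain ⟨k, θ, hk, hθ, hsat, hV⟩ := ih
    choose v hv using hV
    let ι : I ⊕ Fin k → I ⊕ Fin (k + 1) := Sum.map id Fin.castSucc
    let γ : BoolFormula (I ⊕ Fin k) := (g.map fun f => v f.1 f.2).toFormula
    have hι : ∀ (x : I → Bool) (z : Fin (k + 1) → Bool),
        Sum.elim x z ∘ ι = Sum.elim x fun i => z i.castSucc := fun x z => by
      funext i; cases i <;> rfl
    have hγ : ∀ x z, θ.eval (Sum.elim x z) = true →
        γ.eval (Sum.elim x z) = g.eval fun f => f.1 x := fun x z hxz => by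
      rw [BoolGate.eval_toFormula, BoolGate.eval_map]
      exact congrArg g.eval (funext fun f => (hv f.1 f.2 x z hxz).symm)
    let θ' : BoolFormula (I ⊕ Fin (k + 1)) :=
      .and (θ.map ι) ((BoolFormula.var (Sum.inr (Fin.last k))).iff (γ.map ι))
    have heval : ∀ x z, θ'.eval (Sum.elim x z) = true ↔
        θ.eval (Sum.elim x fun i => z i.castSucc) = true ∧
          z (Fin.last k) = γ.eval (Sum.elim x fun i => z i.castSucc) := fun x z => by
      rw [BoolFormula.eval, Bool.and_eq_true, BoolFormula.eval_iff, BoolFormula.eval_map,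
        BoolFormula.eval_map, hι]
      rfl
    refine ⟨k + 1, θ', ?_, ?_, fun x => ?_, ?_⟩
    · cases g <;> simp only [BoolGate.size] <;> omega
    · have : γ.nodes ≤ 3 := by
        simp only [γ]; cases g <;> simp [BoolGate.map, BoolGate.toFormula, BoolFormula.nodes]
      have : 1 ≤ g.size := by cases g <;> simp [BoolGate.size]
      simp only [θ', BoolFormula.iff, BoolFormula.nodes, BoolFormula.nodes_map]
      omega
    · obtain ⟨z, hz⟩ := hsat x
      refine ⟨Fin.snoc z (γ.eval (Sum.elim x z)), (heval _ _).2 ?_⟩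
      simpa using hz
    · rintro f (rfl | hf)
      · refine ⟨Sum.inr (Fin.last k), fun x z hxz => ?_⟩
        obtain ⟨h1, h2⟩ := (heval x z).1 hxz
        exact ((hγ _ _ h1).symm.trans h2.symm)
      · refine ⟨ι (v f hf), fun x z hxz => ?_⟩
        rw [hv f hf x _ ((heval x z).1 hxz).1, ← hι]
        rfl

/-- Existential quantification over some inputs of a small circuit is existential quantification
over the outputs of a small formula. -/
theorem Comp.exists_formula {n l s : ℕ} {f : (Fin n ⊕ Fin l → Bool) → Bool}
    (h : Comp (inputs (Fin n ⊕ Fin l)) s {f}) :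
    ∃ (m : ℕ) (φ : BoolFormula (Fin n ⊕ Fin m)), φ.size ≤ n + l + 15 * s + 3 ∧
      ∀ x, (∃ y, φ.eval (Sum.elim x y) = true) ↔ ∃ c, f (Sum.elim x c) = true := by
  obtain ⟨k, θ, hk, hθ, hsat, hf⟩ := h.exists_tseitin
  obtain ⟨v, hv⟩ := hf f rfl
  let e : (Fin n ⊕ Fin l) ⊕ Fin k ≃ Fin n ⊕ Fin (l + k) :=
    (Equiv.sumAssoc _ _ _).trans (Equiv.sumCongr (Equiv.refl _) finSumFinEquiv)
  have he : ∀ (x : Fin n → Bool) (c : Fin l → Bool) (z : Fin k → Bool),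
      Sum.elim x (Fin.append c z) ∘ e = Sum.elim (Sum.elim x c) z := fun x c z => by
    funext i
    rcases i with (i | i) | i <;> simp [e]
  have heval : ∀ x c z, ((θ.and (.var v)).map e).eval (Sum.elim x (Fin.append c z)) = true ↔
      θ.eval (Sum.elim (Sum.elim x c) z) = true ∧ f (Sum.elim x c) = true := fun x c z => by
    rw [BoolFormula.eval_map, he, BoolFormula.eval, Bool.and_eq_true]
    exact and_congr_right fun h => by rw [hv _ _ h]; rfl
  refine ⟨l + k, (θ.and (.var v)).map e, ?_, fun x => ⟨?_, ?_⟩⟩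
  · simp only [BoolFormula.size, BoolFormula.nodes_map, BoolFormula.nodes, Fintype.card_sum,
      Fintype.card_fin]
    omega
  · rintro ⟨y, hy⟩
    have hy' : y = Fin.append (fun i => y (Fin.castAdd k i)) (fun i => y (Fin.natAdd l i)) := by
      funext i
      refine Fin.addCases (fun i => ?_) (fun i => ?_) i <;> simp
    rw [hy'] at hy
    exact ⟨_, ((heval _ _ _).1 hy).2⟩
  · rintro ⟨c, hc⟩
    obtain ⟨z, hz⟩ := hsat (Sum.elim x c)
    exact ⟨Fin.append c z, (heval _ _ _).2 ⟨hz, hc⟩⟩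

/-- With a Skolem circuit, satisfiability of a specification is decided by evaluating the
specification on the outputs of the circuit. -/
theorem Comp.exists_of_isSkolem {n m : ℕ} {φ : BoolFormula (Fin n ⊕ Fin m)} {C : BoolCircuit n m}
    (hC : C.IsSkolem φ) : Comp (inputs (Fin n)) (Circuit.size C + 3 * φ.nodes)
      {fun x => decide (∃ y, φ.eval (Sum.elim x y) = true)} := by
  have h := (C.comp_eval (W := inputs (Fin n)) (fun x => x) fun i => ⟨i, rfl⟩).step
    (φ.comp_eval (z := fun v x => Sum.elim x (Circuit.eval C x) v) fun v => by
      rcases v with i | j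
      · exact Or.inl ⟨i, rfl⟩
      · exact Or.inr (Set.mem_iUnion.2 ⟨j, rfl⟩))
  convert h using 3 with x
  rw [Bool.eq_iff_iff, decide_eq_true_iff]
  exact ⟨hC x, fun h => ⟨_, h⟩⟩

/-! ### Simulation of Turing machines by circuits -/

section Machine

open Classical in
/-- The unary (one-hot) representation of a function into a finite type. -/
def indicators {D A : Type} (u : D → A) : Set (D → Bool) := ⋃ a, {fun d => decide (u d = a)}

theorem mem_indicators {D A : Type} {u : D → A} (a : A) [∀ d, Decidable (u d = a)] :
    (fun d => decide (u d = a)) ∈ indicators u :=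
  Set.mem_iUnion.2 ⟨a, by simp only [Set.mem_singleton_iff]; funext d; congr⟩

namespace Comp

variable {D A A' : Type} {W : Set (D → Bool)} {u : D → A} {v : D → A'}

open Classical in
theorem indicators_pair [Fintype A] [Fintype A'] (hu : indicators u ⊆ W) (hv : indicators v ⊆ W) :
    Comp W (Fintype.card (A × A') * 3) (indicators fun d => (u d, v d)) := by
  refine iUnion fun p => ?_
  convert and (hu (mem_indicators p.1)) (hv (mem_indicators p.2)) using 3 with d
  rw [← Bool.decide_and]
  exact decide_eq_decide.2 Prod.ext_iff

open Classical in
theorem decide_mem [Fintype A] (hu : indicators u ⊆ W) (S : Set A) :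
    Comp W (1 + 3 * Fintype.card A) {fun d => decide (u d ∈ S)} := by
  have h := exists_or (Finset.univ.filter (· ∈ S)) (f := fun a d => decide (u d = a))
    fun a _ => hu (mem_indicators a)
  refine h.weaken ?_ ?_
  · have := Finset.card_le_univ (Finset.univ.filter (· ∈ S))
    omega
  · simp

theorem indicators_map [Fintype A] [Fintype A'] (hu : indicators u ⊆ W) (G : A → A') :
    Comp W (Fintype.card A' * (1 + 3 * Fintype.card A)) (indicators fun d => G (u d)) :=
  iUnion fun b => decide_mem hu {a | G a = b}

open Classical in
theorem indicators_const [Fintype A] (a : A) :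
    Comp W (Fintype.card A) (indicators fun _ => a) := by
  exact (iUnion fun b => const (decide (a = b))).mono (mul_one _).le

end Comp

open Turing

variable {D Γ Λ : Type} [Inhabited Γ]

/-- The unary representation of the state and of the tape cells at distance at most `R` from the
head in configurations.  Positions are relative to the head. -/
def confBits (R : ℕ) (c : D → TM0.Cfg Γ Λ) : Set (D → Bool) :=
  indicators (fun d => (c d).q) ∪
    ⋃ i ∈ Finset.Icc (-R : ℤ) R, indicators fun d => (c d).Tape.nth i

theorem indicators_nth_subset {R : ℕ} {c : D → TM0.Cfg Γ Λ} {i : ℤ} (h1 : -R ≤ i) (h2 : i ≤ R) :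
    (indicators fun d => (c d).Tape.nth i) ⊆ confBits R c :=
  (Set.subset_biUnion_of_mem (u := fun i : ℤ => indicators fun d => (c d).Tape.nth i)
    (Finset.mem_Icc.2 ⟨h1, h2⟩)).trans Set.subset_union_right

variable [Inhabited Λ]

/-- One step of a machine; halting configurations remain unchanged. -/
def runStep (M : TM0.Machine Γ Λ) (c : TM0.Cfg Γ Λ) : TM0.Cfg Γ Λ :=
  (TM0.step M c).getD c

/-- The state after a step, in terms of the state and the symbol under the head. -/
def nextState (M : TM0.Machine Γ Λ) (p : Λ × Γ) : Λ := ((M p.1 p.2).map Prod.fst).getD p.1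

/-- The symbol at position `i` after a step, in terms of the state, the symbol under the head, and
the symbols at the positions `i - 1`, `i` and `i + 1`. -/
def nextSymbol (M : TM0.Machine Γ Λ) (i : ℤ) (p : (Λ × Γ) × Γ × Γ × Γ) : Γ :=
  match M p.1.1 p.1.2 with
  | none => p.2.2.1
  | some (_, .move .left) => p.2.1
  | some (_, .move .right) => p.2.2.2
  | some (_, .write a) => if i = 0 then a else p.2.2.1

theorem runStep_q (M : TM0.Machine Γ Λ) (c : TM0.Cfg Γ Λ) :
    (runStep M c).q = nextState M (c.q, c.Tape.nth 0) := by
  obtain ⟨q, T⟩ := c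
  simp only [runStep, TM0.step, nextState, Tape.nth_zero]
  cases M q T.head <;> rfl

theorem runStep_nth (M : TM0.Machine Γ Λ) (c : TM0.Cfg Γ Λ) (i : ℤ) :
    (runStep M c).Tape.nth i = nextSymbol M i ((c.q, c.Tape.nth 0), c.Tape.nth (i - 1),
      c.Tape.nth i, c.Tape.nth (i + 1)) := by
  obtain ⟨q, T⟩ := c
  simp only [runStep, TM0.step, nextSymbol, Tape.nth_zero]
  rcases M q T.head with _ | ⟨q', (_ | _) | a⟩
  · rfl
  · exact Tape.move_left_nth T i
  · exact Tape.move_right_nth T i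
  · exact Tape.write_nth a T

/-- A step is a local operation on the tape, so every bit of the new configuration costs only a
constant number of gates. -/
theorem Comp.exists_runStep [Finite Γ] [Finite Λ] (M : TM0.Machine Γ Λ) : ∃ κ : ℕ,
    ∀ {D : Type} (R : ℕ) (c : D → TM0.Cfg Γ Λ),
      Comp (confBits (R + 1) c) ((2 * R + 2) * κ) (confBits R fun d => runStep M (c d)) := by
  have := Fintype.ofFinite Γ
  have := Fintype.ofFinite Λ
  obtain ⟨κ, hκ⟩ : ∃ κ, κ = Fintype.card (Λ × Γ) * 3 + Fintype.card (Γ × Γ) * 3 +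
    Fintype.card (Γ × Γ × Γ) * 3 +
    Fintype.card ((Λ × Γ) × Γ × Γ × Γ) * 3 + Fintype.card Λ * (1 + 3 * Fintype.card (Λ × Γ)) +
    Fintype.card Γ * (1 + 3 * Fintype.card ((Λ × Γ) × Γ × Γ × Γ)) := ⟨_, rfl⟩
  refine ⟨κ, fun {D} R c => ?_⟩
  have hhead := indicators_pair (W := confBits (R + 1) c) (u := fun d => (c d).q)
    (v := fun d => (c d).Tape.nth 0) Set.subset_union_left
    (indicators_nth_subset (by omega) (by omega))
  have hq : Comp (confBits (R + 1) c) κ (indicators fun d => (runStep M (c d)).q) := by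
    simp only [runStep_q]
    exact (hhead.step (indicators_map Set.subset_union_right (nextState M))).mono (by omega)
  have hn : ∀ i ∈ Finset.Icc (-R : ℤ) R,
      Comp (confBits (R + 1) c) κ (indicators fun d => (runStep M (c d)).Tape.nth i) := by
    intro i hi
    rw [Finset.mem_Icc] at hi
    simp only [runStep_nth]
    have h1 := indicators_pair (W := confBits (R + 1) c)
      (u := fun d => (c d).Tape.nth i) (v := fun d => (c d).Tape.nth (i + 1))
      (indicators_nth_subset (by push_cast; omega) (by push_cast; omega))
      (indicators_nth_subset (by push_cast; omega) (by push_cast; omega))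
    have h2 := h1.step (indicators_pair (u := fun d => (c d).Tape.nth (i - 1))
      ((indicators_nth_subset (by push_cast; omega) (by push_cast; omega)).trans
        Set.subset_union_left) Set.subset_union_right)
    have h3 := (hhead.union h2).step (indicators_pair
      (Set.subset_union_left.trans Set.subset_union_right)
      (Set.subset_union_right.trans Set.subset_union_right))
    exact (h3.step (indicators_map Set.subset_union_right (nextSymbol M i))).mono (by omega)
  refine (hq.union (finset_biUnion _ hn)).mono ?_
  have : (Finset.Icc (-R : ℤ) R).card = 2 * R + 1 := by rw [Int.card_Icc]; omega
  rw [this]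
  exact le_of_eq (by ring)

/-- Knowing the cells at distance at most `t` from the head suffices for `t` steps, because the
relevant part of the tape shrinks by one cell on either side in each step. -/
theorem Comp.runStep_iterate {M : TM0.Machine Γ Λ} {κ : ℕ} (hκ : ∀ {D : Type} (R : ℕ)
    (c : D → TM0.Cfg Γ Λ),
      Comp (confBits (R + 1) c) ((2 * R + 2) * κ) (confBits R fun d => runStep M (c d)))
    (t : ℕ) (c : D → TM0.Cfg Γ Λ) :
    Comp (confBits t c) (t * ((2 * t + 2) * κ)) (confBits 0 fun d => (runStep M)^[t] (c d)) := by
  induction t generalizing c with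
  | zero => exact of_subset subset_rfl
  | succ t ih =>
    refine ((hκ t c).trans (ih fun d => runStep M (c d))).mono ?_
    calc (2 * t + 2) * κ + t * ((2 * t + 2) * κ) = (t + 1) * ((2 * t + 2) * κ) := by ring
      _ ≤ _ := by gcongr; omega

theorem runStep_iterate_eq {M : TM0.Machine Γ Λ} {c c' : TM0.Cfg Γ Λ} {t : ℕ}
    (h : StateTransition.EvalsToInTime (TM0.step M) c (some c') t) (hc' : TM0.step M c' = none) :
    (runStep M)^[t] c = c' := by
  have hiter : ∀ k, ∀ c, (flip bind (TM0.step M))^[k] (some c) = some c' →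
      (runStep M)^[k] c = c' := by
    intro k
    induction k with
    | zero => intro c h; simpa using h
    | succ k ih =>
      intro c h
      rw [Function.iterate_succ_apply] at h ⊢
      have h2 : flip bind (TM0.step M) (some c) = TM0.step M c := rfl
      rw [h2] at h
      cases hs : TM0.step M c with
      | none =>
        rw [hs] at h
        have h3 : ∀ k, (flip bind (TM0.step M))^[k] none = none := fun k =>
          Function.iterate_fixed rfl k
        rw [h3] at h
        exact absurd h (by simp)
      | some c₁ =>
        rw [hs] at h
        have : runStep M c = c₁ := by simp [runStep, hs]
        rw [this]
        exact ih c₁ h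
  have h1 := hiter _ _ h.evals_in_steps
  have hfix : runStep M c' = c' := by simp [runStep, hc']
  rw [← Nat.sub_add_cancel h.steps_le_m, Function.iterate_add_apply]
  exact (congrArg _ h1).trans (Function.iterate_fixed hfix _)

theorem nth_mk₁ (l : List Γ) (i : ℤ) :
    (Tape.mk₁ l).nth i = if i < 0 then default else (l[i.toNat]?).getD default := by
  rcases lt_or_ge i 0 with h | h
  · obtain ⟨k, rfl⟩ := Int.eq_negSucc_of_lt_zero h
    rw [if_pos h]
    show (ListBlank.mk []).nth k = default
    simp [ListBlank.nth_mk, List.getI]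
  · lift i to ℕ using h
    rw [if_neg (by omega), Int.toNat_natCast]
    rw [show Tape.mk₁ l = Tape.mk' (ListBlank.mk []) (ListBlank.mk l) from rfl, Tape.mk'_nth_nat,
      ListBlank.nth_mk, List.getI_eq_getElem?_getD]

/-- Every cell of the initial tape depends on at most one bit of the input. -/
theorem exists_initial_symbol {n l : ℕ} (sym : Option Bool → Γ) (i : ℤ) :
    (∃ a, ∀ d : Fin n ⊕ Fin l → Bool, (Tape.mk₁ ((pairWord (List.ofFn fun i => d (Sum.inl i))
      (List.ofFn fun j => d (Sum.inr j))).map sym)).nth i = a) ∨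
    ∃ (v : Fin n ⊕ Fin l) (G : Bool → Γ), ∀ d : Fin n ⊕ Fin l → Bool,
      (Tape.mk₁ ((pairWord (List.ofFn fun i => d (Sum.inl i))
      (List.ofFn fun j => d (Sum.inr j))).map sym)).nth i = G (d v) := by
  simp only [nth_mk₁]
  rcases lt_or_ge i 0 with h | h
  · exact Or.inl ⟨default, fun d => if_pos h⟩
  · lift i to ℕ using h
    simp only [Int.toNat_natCast, Int.natCast_nonneg, not_lt.2, if_false, List.getElem?_map,
      pairWord]
    rcases lt_trichotomy i n with h | h | h
    · refine Or.inr ⟨Sum.inl ⟨i, h⟩, fun b => sym (some b), fun d => ?_⟩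
      rw [List.getElem?_append_left (by simpa using h)]
      simp [h]
    · refine Or.inl ⟨sym none, fun d => ?_⟩
      rw [List.getElem?_append_right (by simp [h])]
      simp [h]
    · obtain ⟨k, rfl⟩ := Nat.exists_eq_add_of_lt h
      rcases lt_or_ge k l with hk | hk
      · refine Or.inr ⟨Sum.inr ⟨k, hk⟩, fun b => sym (some b), fun d => ?_⟩
        rw [List.getElem?_append_right (by simp; omega)]
        simp [hk, show n + k + 1 - n = k + 1 by omega]
      · refine Or.inl ⟨default, fun d => ?_⟩
        rw [List.getElem?_append_right (by simp; omega)]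
        simp [hk, show n + k + 1 - n = k + 1 by omega]

theorem Comp.initial [Fintype Γ] [Fintype Λ] {n l : ℕ} (sym : Option Bool → Γ) (R : ℕ) :
    Comp (inputs (Fin n ⊕ Fin l)) (Fintype.card Λ + (2 * R + 1) * (2 * Fintype.card Γ))
      (confBits R fun d : Fin n ⊕ Fin l → Bool => (TM0.init ((pairWord
        (List.ofFn fun i => d (Sum.inl i)) (List.ofFn fun j => d (Sum.inr j))).map sym) :
          TM0.Cfg Γ Λ)) := by
  have hcard : (Finset.Icc (-R : ℤ) R).card = 2 * R + 1 := by rw [Int.card_Icc]; omega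
  have h := (indicators_const (W := inputs (Fin n ⊕ Fin l)) (default : Λ)).union
    (finset_biUnion (Finset.Icc (-R : ℤ) R) (s := 2 * Fintype.card Γ)
      (V := fun i => indicators fun d : Fin n ⊕ Fin l → Bool => (Tape.mk₁ ((pairWord
        (List.ofFn fun i => d (Sum.inl i)) (List.ofFn fun j => d (Sum.inr j))).map sym)).nth i)
      fun i _ => ?_)
  · rwa [hcard] at h
  · rcases exists_initial_symbol (n := n) (l := l) sym i with ⟨a, ha⟩ | ⟨v, G, hG⟩
    · simp only [ha]
      exact (indicators_const a).mono (by omega)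
    · simp only [hG]
      refine (iUnion (s := 2) fun b => ?_).mono (t := 2 * Fintype.card Γ) (by omega)
      exact apply₁ (fun x => @decide (G x = b) (Classical.propDecidable _))
        (f := fun d : Fin n ⊕ Fin l → Bool => d v) ⟨v, rfl⟩

open Classical in
/-- Polynomial-time decidable languages of pairs have polynomial-size circuits, for fixed lengths of
both components. -/
theorem PolyTimeDecidable.exists_comp {V : Language (Option Bool)} (hV : PolyTimeDecidable V) :
    ∃ S : Polynomial ℕ, ∀ n l : ℕ, Comp (inputs (Fin n ⊕ Fin l)) (S.eval (n + l))
      {fun d => decide (pairWord (List.ofFn fun i => d (Sum.inl i))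
        (List.ofFn fun j => d (Sum.inr j)) ∈ V)} := by
  obtain ⟨M, p, hM⟩ := hV
  have := Fintype.ofFinite M.Γ
  have := Fintype.ofFinite M.Λ
  obtain ⟨κ, hκ⟩ := Comp.exists_runStep M.machine
  open Polynomial in
  let T : Polynomial ℕ := p.comp (X + 1)
  open Polynomial in
  refine ⟨C (Fintype.card M.Λ) + (2 * T + 1) * C (2 * Fintype.card M.Γ) + T * ((2 * T + 2) * C κ) +
    C (1 + 3 * Fintype.card M.Λ), fun n l => ?_⟩
  have hT : T.eval (n + l) = p.eval (n + l + 1) := by simp [T, Polynomial.eval_comp]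
  simp only [Polynomial.eval_add, Polynomial.eval_mul, Polynomial.eval_C, Polynomial.eval_ofNat,
    Polynomial.eval_one, hT]
  set t := p.eval (n + l + 1) with ht
  have h := ((Comp.initial (Λ := M.Λ) (n := n) (l := l) M.sym t).trans
    (Comp.runStep_iterate hκ t _)).trans (Comp.decide_mem Set.subset_union_left M.accept)
  convert h using 3 with d
  set x := pairWord (List.ofFn fun i => d (Sum.inl i)) (List.ofFn fun j => d (Sum.inr j)) with hx
  obtain ⟨c, ⟨⟨hc⟩, hhalt⟩, hacc⟩ := hM x
  have hlen : x.length = n + l + 1 := by simp [hx, pairWord]; omega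
  rw [hlen, ← ht] at hc
  refine decide_eq_decide.2 (hacc.trans ?_)
  show _ ↔ ((runStep M.machine)^[t] (TM0.init (x.map M.sym))).q ∈ M.accept
  rw [runStep_iterate_eq hc hhalt]

end Machine

/-! ### NP and P/poly -/

theorem natPolynomial_eval_mono (p : Polynomial ℕ) : Monotone fun n => p.eval n := by
  intro a b hab
  simp only [Polynomial.eval_eq_sum_range]
  gcongr

open Classical in
/-- For each length `l` of certificates, the existence of an accepted certificate is expressed by a
Boolean specification of polynomial size whose outputs are the certificate and the gates of a
circuit for the verifier; it is decided by a Skolem circuit.  The disjunction over `l` decides the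
language. -/
theorem np_subset_pPoly (h : PolyBounded SBool) : NP ⊆ PPoly := by
  obtain ⟨P, hP⟩ := h
  rintro L ⟨V, p, hV, hL⟩
  obtain ⟨S, hS⟩ := hV.exists_comp
  open Polynomial in
  let N : Polynomial ℕ := X + p + 15 * S.comp (X + p) + 3
  open Polynomial in
  refine ⟨X + 1 + ((p + 1) * (P.comp N + 3 * N) + (1 + 3 * (p + 1))), fun n => ?_⟩
  have hN : N.eval n = n + p.eval n + 15 * S.eval (n + p.eval n) + 3 := by
    simp [N, Polynomial.eval_comp]
  have hl : ∀ l : Fin (p.eval n + 1), Comp (inputs (Fin n))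
      (P.eval (N.eval n) + 3 * N.eval n) {fun x => decide (∃ c : Fin l → Bool,
        pairWord (List.ofFn x) (List.ofFn c) ∈ V)} := by
    intro l
    obtain ⟨m, φ, hφ, hx⟩ := (hS n l).exists_formula
    have hφN : φ.size ≤ N.eval n := by
      have hln : n + (l : ℕ) ≤ n + p.eval n := by have := l.2; omega
      have := natPolynomial_eval_mono S hln
      simp only at this
      omega
    obtain ⟨C, hC, hCs⟩ := exists_skolem_of_SBool_le φ hφN (hP _)
    have h := Comp.exists_of_isSkolem hC
    have hnodes : φ.nodes ≤ φ.size := Nat.le_add_right _ _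
    convert h.mono (t := P.eval (N.eval n) + 3 * N.eval n) (by omega) using 3 with x
    exact decide_eq_decide.2 ((exists_congr fun c => decide_eq_true_iff.symm).trans (hx x).symm)
  have hor := (Comp.iUnion hl).step (Comp.exists_or Finset.univ
    (f := fun (l : Fin (p.eval n + 1)) x => decide (∃ c : Fin l → Bool,
        pairWord (List.ofFn x) (List.ofFn c) ∈ V))
    fun l _ => Or.inr (Set.mem_iUnion.2 ⟨l, rfl⟩))
  have hout : Comp (inputs (Fin n)) ((p.eval n + 1) * (P.eval (N.eval n) + 3 * N.eval n) +
      (1 + 3 * (p.eval n + 1)))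
      (⋃ j : Fin 1, {fun x => (fun (x : Fin n → Bool) (_ : Fin 1) =>
        decide (List.ofFn x ∈ L)) x j}) := by
    refine Comp.weaken hor (by simp) ?_
    intro f hf
    obtain ⟨j, rfl⟩ := Set.mem_iUnion.1 hf
    rw [Set.mem_singleton_iff]
    funext x
    refine decide_eq_decide.2 ((hL _).trans ?_)
    simp only [Finset.mem_univ, true_and, decide_eq_true_eq, List.length_ofFn]
    constructor
    · rintro ⟨w, hw, hwV⟩
      exact ⟨⟨w.length, by omega⟩, w.get, by simpa using hwV⟩
    · rintro ⟨l, c, hc⟩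
      exact ⟨List.ofFn c, by simpa using Nat.lt_succ_iff.1 l.2, hc⟩
  obtain ⟨C, hC, heval⟩ := hout.exists_circuit
  refine ⟨C, hC.trans (le_of_eq ?_), fun x => ?_⟩
  · simp [Polynomial.eval_comp]
  · rw [heval]; simp

end PFnS

theorem mainTheorem3 :
    (PFnS.PolyBounded PFnS.S1PA → PFnS.PolyBounded PFnS.SBool) ∧
    (PFnS.PolyBounded PFnS.S1PA → PFnS.NP ⊆ PFnS.PPoly) :=
  ⟨PFnS.polyBounded_SBool, fun h => PFnS.np_subset_pPoly (PFnS.polyBounded_SBool h)⟩
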